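/- Let $P^A, P^B, Q$ be probability distributions on a standard Borel space $\mathcal Y$ with densities (or probability mass functions) $P^A(y), P^B(y), Q(y)$ with respect to a common reference measure. Put $\omega_A=\sup_y P^A(y)/Q(y)$, $\omega_B=\sup_y P^B(y)/Q(y)$ (with $0/0=0$ and $a/0=\infty$ for $a>0$) and let $\omega<\infty$ satisfy $\max(\omega_A,\omega_B)\le\omega$. Let $N\ge 2$. **Common randomness.** $W=((B_i,U_i))_{i\ge 1}$ with $B_i=((Y_{i1},S_{i1}),\dots,(Y_{iN},S_{iN}))$, where all the variables $Y_{ij}\sim Q$, $S_{ij}\sim\mathrm{Exp}(1)$, $U_i\sim\mathrm{Unif}(0,1)$ are mutually independent. **Ensemble rejection sampling (ERS).** For a target $P$ with $\omega_P=\sup_y P(y)/Q(y)<\infty$, put $\lambda_{ik}=P(Y_{ik})/Q(Y_{ik})$, let $k_i=\operatorname{argmin}_{1\le k\le N} S_{ik}/\lambda_{ik}$ be the candidate of batch $i$, and accept batch $i$ if $$U_i\le \frac{\hat Z_i}{\hat Z_i+\omega_P-\lambda_{i,k_i}},\qquad \hat Z_i=\sum_{k=1}^N\lambda_{ik}.$$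 The selected index is $K=(K_1,k_{K_1})$, where $K_1$ is the first accepted batch, and the output is $Y_K=Y_{K_1,k_{K_1}}$. Without communication, parties $A$ and $B$ apply ERS to the same $W$ with targets $P^A$ and $P^B$ (using $\omega_A$ and $\omega_B$ respectively), which gives $K_A$ and $K_B$. **Coefficients.** For a target $P$ let $d_2(Q\|P)=\mathbb E_{Y\sim Q}[Q(Y)/P(Y)]\in[0,\infty]$, let $\mathbb I_N(\omega,i)=2\cdot\mathbf 1_{N>i}+\omega\,\mathbf 1_{N=i}$, and put $$\mu_1(N)=\frac1N\Big[\omega+\omega\,\mathbb I_N(\omega,2)\,d_2(Q\|P^B)+\frac{\omega^2}{N-1}d_2(Q\|P^B)\Big],$$ $$\mu_2(N)=\frac1N\Big[\omega+\omega\,\mathbb I_N(\omega,2)\,d_2(Q\|P^A)+\frac{\omega^2}{N-1}d_2(Q\|P^A)\Big].$$ **Claim.** For $P^A$-almost every $y$, $$\Pr\big(Y_{K_A}=Y_{K_B}\,\big|\,Y_{K_A}=y\big)\ \ge\ \Big(1+\mu_1(N)+\frac{P^A(y)}{P^B(y)}\,\big(1+\mu_2(N)\big)\Big)^{-1},$$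 where the right-hand side is $0$ if the expression in parentheses is infinite. Moreover, with $\omega$ and the distributions fixed, $\mu_1(N)\to0$ as $N\to\infty$ if $d_2(Q\|P^B)<\infty$, and $\mu_2(N)\to0$ as $N\to\infty$ if $d_2(Q\|P^A)<\infty$. -/

import Mathlib

open MeasureTheory ProbabilityTheory Filter Topology
open scoped NNReal ENNReal

noncomputable section

namespace ERSMatching

/-- `p` is a probability density with respect to the reference measure `ν`
(for instance Lebesgue measure, or counting measure for probability mass functions). -/
structure IsDensity {𝒴 : Type*} [MeasurableSpace 𝒴] (ν : Measure 𝒴) (p : 𝒴 → ℝ≥0) : Prop where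
  measurable : Measurable p
  lintegral_eq_one : ∫⁻ y, (p y : ℝ≥0∞) ∂ν = 1

/-- The distribution with density `p` with respect to `ν`. -/
def densityMeasure {𝒴 : Type*} [MeasurableSpace 𝒴] (ν : Measure 𝒴) (p : 𝒴 → ℝ≥0) : Measure 𝒴 :=
  ν.withDensity (fun y => (p y : ℝ≥0∞))

/-- The ratio `p(y) / q(y)` as an extended nonnegative real: `0 / 0 = 0`, and `a / 0 = ∞` for
`a > 0`. -/
def ratio {𝒴 : Type*} (p q : 𝒴 → ℝ≥0) (y : 𝒴) : ℝ≥0∞ := (p y : ℝ≥0∞) / (q y : ℝ≥0∞)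

/-- `sup_y p(y) / q(y)`. It is finite only if `p` vanishes wherever `q` does. -/
def supRatio {𝒴 : Type*} (p q : 𝒴 → ℝ≥0) : ℝ≥0∞ := ⨆ y, ratio p q y

/-- `d₂(Q ‖ P) = E_{Y ∼ Q} [q(Y) / p(Y)]`, possibly infinite. -/
def d2 {𝒴 : Type*} [MeasurableSpace 𝒴] (ν : Measure 𝒴) (q p : 𝒴 → ℝ≥0) : ℝ≥0∞ :=
  ∫⁻ y, ratio q p y ∂(densityMeasure ν q)

/-- One entry `(B, U)` of the common randomness: the batch `B = ((Y_1, S_1), …, (Y_N, S_N))`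
together with `U`. -/
abbrev Entry (N : ℕ) (𝒴 : Type*) : Type _ := (Fin N → 𝒴 × ℝ) × ℝ

/-- The law of an entry: the `Y_j ∼ Q`, the `S_j ∼ Exp(1)` and `U ∼ Unif(0,1)` are all
independent. -/
def entryLaw {𝒴 : Type*} [MeasurableSpace 𝒴] (N : ℕ) (Q : Measure 𝒴) : Measure (Entry N 𝒴) :=
  (Measure.pi fun _ : Fin N => Q.prod (expMeasure 1)).prod
    ((volume : Measure ℝ).restrict (Set.Ioo 0 1))

/-- `W = (W 0, W 1, …)` is an i.i.d. sequence of entries with proposal distribution `Q`. -/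
structure IsCommonRandomness {Ω 𝒴 : Type*} [MeasurableSpace Ω] [MeasurableSpace 𝒴] {N : ℕ}
    (μ : Measure Ω) (Q : Measure 𝒴) (W : ℕ → Ω → Entry N 𝒴) : Prop where
  hasLaw : ∀ i, HasLaw (W i) (entryLaw N Q) μ
  indep : iIndepFun W μ

section Algorithm

variable {𝒴 : Type*} {N : ℕ}

/-- The Gumbel-max score `S_k / λ_k`, where `λ_k = p(Y_k) / q(Y_k)`; it is `∞` if `λ_k = 0` and
`S_k > 0`. -/
def score (p q : 𝒴 → ℝ≥0) (b : Fin N → 𝒴 × ℝ) (k : Fin N) : ℝ≥0∞ :=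
  ENNReal.ofReal (b k).2 / ratio p q (b k).1

theorem exists_score_le [NeZero N] (p q : 𝒴 → ℝ≥0) (b : Fin N → 𝒴 × ℝ) :
    ∃ k, ∀ j, score p q b k ≤ score p q b j :=
  Finite.exists_min (score p q b)

open Classical in
/-- The candidate `argmin_k S_k / λ_k`; ties are broken in favour of the least index. -/
def candidate [NeZero N] (p q : 𝒴 → ℝ≥0) (b : Fin N → 𝒴 × ℝ) : Fin N :=
  (Finset.univ.filter fun k => ∀ j, score p q b k ≤ score p q b j).min' (by
    obtain ⟨k, hk⟩ := exists_score_le p q b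
    exact ⟨k, by simpa using hk⟩)

/-- `Ẑ = ∑_k λ_k`. -/
def zHat (p q : 𝒴 → ℝ≥0) (b : Fin N → 𝒴 × ℝ) : ℝ≥0∞ := ∑ k, ratio p q (b k).1

/-- `Z̄(k) = Ẑ + ω - λ_k`. -/
def zBar (p q : 𝒴 → ℝ≥0) (ω : ℝ≥0∞) (b : Fin N → 𝒴 × ℝ) (k : Fin N) : ℝ≥0∞ :=
  zHat p q b + ω - ratio p q (b k).1

/-- The acceptance test `U ≤ Ẑ / Z̄(candidate)` for one entry. -/
def Accepts [NeZero N] (p q : 𝒴 → ℝ≥0) (ω : ℝ≥0∞) (e : Entry N 𝒴) : Prop :=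
  ENNReal.ofReal e.2 ≤ zHat p q e.1 / zBar p q ω e.1 (candidate p q e.1)

/-- Ensemble rejection sampling: the pair of the batch index (the first accepted batch, counted
from `0`) and the local index (its candidate). If no batch is accepted, an event of
probability zero, the batch index is `0` by convention. -/
def ers [NeZero N] (p q : 𝒴 → ℝ≥0) (ω : ℝ≥0∞) (w : ℕ → Entry N 𝒴) : ℕ × Fin N :=
  let K₁ := sInf {i | Accepts p q ω (w i)}
  (K₁, candidate p q (w K₁).1)

/-- The sample `Y_K = Y_{K₁, K₂}`. -/
def sampleAt (w : ℕ → Entry N 𝒴) (K : ℕ × Fin N) : 𝒴 := ((w K.1).1 K.2).1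

end Algorithm

/-- The conditional probability `Pr(E | X = x)`, through the regular conditional distribution
of the truth value of `E` given `X`; it is determined for almost every `x`. -/
def condProbGiven {Ω 𝒴 : Type*} [MeasurableSpace Ω] [MeasurableSpace 𝒴] (μ : Measure Ω)
    [IsFiniteMeasure μ] (E : Ω → Prop) (X : Ω → 𝒴) (x : 𝒴) : ℝ≥0∞ :=
  condDistrib E X μ x {True}

/-- `𝕀_N(ω, i) = 2 · 1[N > i] + ω · 1[N = i]`. -/
def indic (N : ℕ) (ω : ℝ≥0∞) (i : ℕ) : ℝ≥0∞ :=
  2 * (if N > i then 1 else 0) + ω * (if N = i then 1 else 0)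

/-- `(1/N) [ω + ω 𝕀_N(ω, 2) d + ω² / (N - 1) d]`; with `d = d₂(Q ‖ P^B)` this is `μ₁(N)` and with
`d = d₂(Q ‖ P^A)` it is `μ₂(N)`. -/
def coeff (ω d : ℝ≥0∞) (N : ℕ) : ℝ≥0∞ :=
  (1 / (N : ℝ≥0∞)) * (ω + ω * indic N ω 2 * d + ω ^ 2 / ((N : ℝ≥0∞) - 1) * d)

end ERSMatching

end

/-!
Write `λA = pA / q`, `λB = pB / q`, `r = pA / pB`, and `ẐA`, `ẐB` for the sums of `λA`, `λB` over
a batch. The conditional probability is bounded from below by looking at the first batch alone: if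
both targets accept it with the same candidate `k`, the outputs agree
(`IsCommonRandomness.entryLaw_matchedIn_le`). This loses nothing in the claimed bound, which
comes from estimating the probability that some target accepts by one.

Given the points of the batch, the clocks `S` run an exponential race (`pi_expMeasure_race`), and
`k` wins it for both targets with probability at least `λA_k / (ẐA + r ẐB)`, where `r` is taken at
the point of `k`. The uniform variable is independent of the clocks, and passes both tests with
probability at least `(1 + (ωA - λA_k) / ẐA + (ωB - λB_k) / ẐB)⁻¹`. The product is
`λA_k / couplingCost`. Integrating over the other points and applying Jensen's inequality to the
reciprocal leaves the mean of `couplingCost`; expanded, its only nontrivial terms are the means of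
`ẐA / ẐB` and `ẐB / ẐA`. Dropping terms from the denominators makes them independent of the
numerators, and the inequality between harmonic and arithmetic means produces the `d₂` terms of
the coefficients (`lintegral_couplingCost_le`).

To pass from this to a conditional probability given the output of `A`, the law of that output has
to be `pA` exactly. The bounds `λ_k / Ẑ` for the candidate of one target sum to one, so they are
equalities (`pi_candidate_eq`); the chance that a batch is accepted with its candidate in `D`
is then a constant times the mass of `D` (`entryLaw_accepts_and_mem`), and a geometric series over
the first accepted batch removes the constant (`IsCommonRandomness.map_ersSample`).
-/

namespace ERSMatching

/-! ### The exponential race, the uniform test, and Jensen's inequality -/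

instance isProbabilityMeasure_expMeasure_one : IsProbabilityMeasure (expMeasure 1) :=
  isProbabilityMeasure_expMeasure one_pos

theorem expMeasure_one_Ioi {x : ℝ} (hx : 0 ≤ x) :
    expMeasure 1 (Set.Ioi x) = ENNReal.ofReal (Real.exp (-x)) := by
  have h := cdf_expMeasure_eq one_pos x
  rw [if_pos hx, cdf_eq_real, measureReal_def, one_mul] at h
  have h1 : expMeasure 1 (Set.Iic x) = ENNReal.ofReal (1 - Real.exp (-x)) := by
    rw [← h, ENNReal.ofReal_toReal (measure_ne_top _ _)]
  have h2 : Real.exp (-x) ≤ 1 := Real.exp_le_one_iff.2 (by linarith)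
  rw [← Set.compl_Iic, prob_compl_eq_one_sub measurableSet_Iic, h1, ← ENNReal.ofReal_one,
    ← ENNReal.ofReal_sub _ (by linarith)]
  congr 1
  ring

/-- The Laplace transform of the exponential distribution. -/
theorem lintegral_expMeasure_one_exp {M : ℝ} (hM : 0 ≤ M) :
    ∫⁻ x, (if 0 < x then ENNReal.ofReal (Real.exp (-(M * x))) else 0) ∂(expMeasure 1)
      = (ENNReal.ofReal (1 + M))⁻¹ := by
  have hd : expMeasure 1 = volume.withDensity (exponentialPDF 1) := rfl
  have hm : ∀ r, Measurable (exponentialPDF r) := fun r =>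
    (measurable_exponentialPDFReal r).ennreal_ofReal
  have hm' : Measurable fun x : ℝ =>
      if 0 < x then ENNReal.ofReal (Real.exp (-(M * x))) else 0 :=
    Measurable.ite measurableSet_Ioi (by fun_prop) measurable_const
  rw [hd, lintegral_withDensity_eq_lintegral_mul _ (hm 1) hm']
  have hM' : 0 < 1 + M := by linarith
  have key : (exponentialPDF 1 * fun x : ℝ =>
      if 0 < x then ENNReal.ofReal (Real.exp (-(M * x))) else 0)
      =ᵐ[volume] fun x => ENNReal.ofReal (1 + M)⁻¹ * exponentialPDF (1 + M) x := by
    have h0 : ∀ᵐ x : ℝ, x ≠ 0 := by simp [ae_iff]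
    filter_upwards [h0] with x hx
    rcases lt_or_gt_of_ne hx with h | h
    · simp [exponentialPDF_of_neg h]
    · rw [Pi.mul_apply, exponentialPDF_of_nonneg h.le, exponentialPDF_of_nonneg h.le, if_pos h,
        ← ENNReal.ofReal_mul (by positivity), ← ENNReal.ofReal_mul (by positivity), one_mul,
        ← Real.exp_add, ← mul_assoc, inv_mul_cancel₀ hM'.ne', one_mul]
      ring_nf
  rw [lintegral_congr_ae key, lintegral_const_mul _ (hm _), lintegral_exponentialPDF_eq_one hM',
    mul_one, ENNReal.ofReal_inv_of_pos hM']

/-- The exponential race: the clock `k` rings before all the clocks `j` of rate `1 / m j`. -/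
theorem pi_expMeasure_race {n : ℕ} (k : Fin (n + 1)) (m : Fin n → ℝ≥0) :
    (Measure.pi fun _ : Fin (n + 1) => expMeasure 1)
      {s | 0 < s k ∧ ∀ j, (m j : ℝ) * s k < s (k.succAbove j)}
      = (1 + ∑ j, (m j : ℝ≥0∞))⁻¹ := by
  set T : Set (ℝ × (Fin n → ℝ)) := {p | 0 < p.1 ∧ ∀ j, (m j : ℝ) * p.1 < p.2 j} with hT
  have hTm : MeasurableSet T := by
    have : T = {p | 0 < p.1} ∩ ⋂ j, {p | (m j : ℝ) * p.1 < p.2 j} := by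
      ext p
      simp [hT]
    rw [this]
    exact (measurableSet_lt measurable_const measurable_fst).inter
      (MeasurableSet.iInter fun j => measurableSet_lt (by fun_prop) (by fun_prop))
  have hmp := measurePreserving_piFinSuccAbove (fun _ : Fin (n + 1) => expMeasure 1) k
  have h1 := hmp.measure_preimage hTm.nullMeasurableSet
  have h2 : (MeasurableEquiv.piFinSuccAbove (fun _ : Fin (n + 1) => ℝ) k) ⁻¹' T
      = {s | 0 < s k ∧ ∀ j, (m j : ℝ) * s k < s (k.succAbove j)} := by
    ext s
    simp [hT, MeasurableEquiv.piFinSuccAbove, Fin.insertNthEquiv, Fin.removeNth]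
  rw [← h2, h1, Measure.prod_apply hTm]
  have h3 : ∀ x : ℝ, (Measure.pi fun _ : Fin n => expMeasure 1) (Prod.mk x ⁻¹' T)
      = if 0 < x then ENNReal.ofReal (Real.exp (-((∑ j, (m j : ℝ)) * x))) else 0 := by
    intro x
    split_ifs with hx
    · have : Prod.mk x ⁻¹' T = Set.univ.pi fun j => Set.Ioi ((m j : ℝ) * x) := by
        ext t
        simp [hT, hx]
      have hj : ∀ j, expMeasure 1 (Set.Ioi ((m j : ℝ) * x))
          = ENNReal.ofReal (Real.exp (-((m j : ℝ) * x))) := fun j =>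
        expMeasure_one_Ioi (mul_nonneg (m j).2 hx.le)
      simp_rw [this, Measure.pi_pi, hj]
      rw [← ENNReal.ofReal_prod_of_nonneg fun _ _ => (Real.exp_pos _).le,
        ← Real.exp_sum, Finset.sum_neg_distrib, Finset.sum_mul]
    · have : Prod.mk x ⁻¹' T = ∅ := by
        ext t
        simp [hT, hx]
      rw [this, measure_empty]
  have hM : 0 ≤ ∑ j, (m j : ℝ) := Finset.sum_nonneg fun j _ => (m j).2
  rw [lintegral_congr h3, lintegral_expMeasure_one_exp hM, ENNReal.ofReal_add zero_le_one hM,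
    ENNReal.ofReal_one, ← NNReal.coe_sum, ENNReal.ofReal_coe_nnreal, ENNReal.ofNNReal_finsetSum]

theorem volume_restrict_Ioo_ofReal_le {t : ℝ≥0∞} (ht : t ≤ 1) :
    ((volume : Measure ℝ).restrict (Set.Ioo 0 1)) {u | ENNReal.ofReal u ≤ t} = t := by
  have hm : MeasurableSet {u : ℝ | ENNReal.ofReal u ≤ t} :=
    measurableSet_le ENNReal.measurable_ofReal measurable_const
  have ht' : t ≠ ∞ := ne_top_of_le_ne_top ENNReal.one_ne_top ht
  have hle : t.toReal ≤ 1 := ENNReal.toReal_mono ENNReal.one_ne_top ht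
  rw [restrict_Ioo_eq_restrict_Ioc, Measure.restrict_apply hm]
  have : {u : ℝ | ENNReal.ofReal u ≤ t} ∩ Set.Ioc 0 1 = Set.Ioc 0 t.toReal := by
    ext u
    simp only [Set.mem_inter_iff, Set.mem_ofPred_eq, Set.mem_Ioc]
    rw [ENNReal.ofReal_le_iff_le_toReal ht']
    constructor
    · rintro ⟨h1, h2, -⟩
      exact ⟨h2, h1⟩
    · rintro ⟨h1, h2⟩
      exact ⟨h2, h1, h2.trans hle⟩
  rw [this, Real.volume_Ioc, sub_zero, ENNReal.ofReal_toReal ht']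

/-- Jensen's inequality for the inverse: integrate the tangent bound
`2 / m ≤ 1 / x + x / m²` at `m = ∫ f`. -/
theorem inv_lintegral_le_lintegral_inv {α : Type*} [MeasurableSpace α] (P : Measure α)
    [IsProbabilityMeasure P] {f : α → ℝ≥0∞} (hf : Measurable f) :
    (∫⁻ a, f a ∂P)⁻¹ ≤ ∫⁻ a, (f a)⁻¹ ∂P := by
  set m := ∫⁻ a, f a ∂P with hm
  by_cases hm0 : m = 0
  · have h := (lintegral_eq_zero_iff hf).1 (hm ▸ hm0)
    have : ∫⁻ a, (f a)⁻¹ ∂P = ∫⁻ _, ∞ ∂P :=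
      lintegral_congr_ae (h.mono fun a ha => by simp only [ha, Pi.zero_apply, ENNReal.inv_zero])
    rw [this]
    simp
  by_cases hmt : m = ∞
  · simp [hmt]
  have tangent : ∀ x : ℝ≥0∞, 2 * m⁻¹ ≤ x⁻¹ + x * (m⁻¹ * m⁻¹) := by
    intro x
    rcases eq_or_ne x 0 with rfl | hx0
    · simp
    rcases eq_or_ne x ∞ with rfl | hxt
    · have : m⁻¹ * m⁻¹ ≠ 0 := by simp [hmt]
      rw [ENNReal.top_mul this]
      simp
    lift x to ℝ≥0 using hxt
    lift m to ℝ≥0 using hmt with m'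
    have hx0' : x ≠ 0 := by exact_mod_cast hx0
    have hm0' : m' ≠ 0 := by exact_mod_cast hm0
    rw [← ENNReal.coe_inv hx0', ← ENNReal.coe_inv hm0']
    norm_cast
    rw [← NNReal.coe_le_coe]
    push_cast
    have hx : (0 : ℝ) < x := by exact_mod_cast pos_iff_ne_zero.2 hx0'
    have : (x : ℝ)⁻¹ + x * ((m' : ℝ)⁻¹ * (m' : ℝ)⁻¹) - 2 * (m' : ℝ)⁻¹
        = x * ((x : ℝ)⁻¹ - (m' : ℝ)⁻¹) ^ 2 := by
      field_simp
      ring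
    nlinarith [mul_nonneg hx.le (sq_nonneg ((x : ℝ)⁻¹ - (m' : ℝ)⁻¹))]
  have h : 2 * m⁻¹ ≤ ∫⁻ a, (f a)⁻¹ ∂P + m⁻¹ := by
    calc 2 * m⁻¹ = ∫⁻ _, 2 * m⁻¹ ∂P := by simp
      _ ≤ ∫⁻ a, ((f a)⁻¹ + f a * (m⁻¹ * m⁻¹)) ∂P := lintegral_mono fun a => tangent (f a)
      _ = ∫⁻ a, (f a)⁻¹ ∂P + m⁻¹ := by
        rw [lintegral_add_left (f := fun a => (f a)⁻¹) hf.inv, lintegral_mul_const _ hf, ← hm,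
          ← mul_assoc, ENNReal.mul_inv_cancel hm0 hmt, one_mul]
  rw [two_mul] at h
  exact (ENNReal.add_le_add_iff_right (ENNReal.inv_ne_top.2 hm0)).1 h

/-- The inequality between the harmonic and the arithmetic mean. -/
theorem inv_sum_le_sum_inv {m : ℕ} (hm : m ≠ 0) (x : Fin m → ℝ≥0∞) :
    (∑ j, x j)⁻¹ ≤ (m : ℝ≥0∞)⁻¹ * ((m : ℝ≥0∞)⁻¹ * ∑ j, (x j)⁻¹) := by
  have hm0 : (m : ℝ≥0∞) ≠ 0 := by exact_mod_cast hm
  have hmt : (m : ℝ≥0∞) ≠ ∞ := ENNReal.natCast_ne_top m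
  let P : Measure (Fin m) := (m : ℝ≥0∞)⁻¹ • Measure.count
  have : IsProbabilityMeasure P := ⟨by
    simp [P, ENNReal.inv_mul_cancel hm0 hmt]⟩
  have h := inv_lintegral_le_lintegral_inv P (f := x) (measurable_of_finite x)
  simp only [P, lintegral_smul_measure, lintegral_count, tsum_fintype, smul_eq_mul] at h
  rw [ENNReal.mul_inv (by simp) (by simp [hm]), inv_inv] at h
  calc (∑ j, x j)⁻¹ = (m : ℝ≥0∞)⁻¹ * (m * (∑ j, x j)⁻¹) := by
        rw [← mul_assoc, ENNReal.inv_mul_cancel hm0 hmt, one_mul]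
    _ ≤ _ := by gcongr

/-! ### The candidate of a batch -/

section Score

variable {𝒴 : Type*} {N : ℕ}

theorem score_lt_score (p q : 𝒴 → ℝ≥0) (b : Fin N → 𝒴 × ℝ) (k j : Fin N) (m : ℝ≥0)
    (h0 : ratio p q (b k).1 ≠ 0) (htop : ratio p q (b k).1 ≠ ∞)
    (hm : ratio p q (b j).1 ≤ m * ratio p q (b k).1) (hs : 0 < (b k).2)
    (hlt : (m : ℝ) * (b k).2 < (b j).2) : score p q b k < score p q b j := by
  have hj : 0 < (b j).2 := lt_of_le_of_lt (mul_nonneg m.coe_nonneg hs.le) hlt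
  have hjt : ratio p q (b j).1 ≠ ∞ :=
    ne_top_of_le_ne_top (ENNReal.mul_ne_top ENNReal.coe_ne_top htop) hm
  unfold score
  rcases eq_or_ne (ratio p q (b j).1) 0 with hz | hz
  · rw [hz, ENNReal.div_zero (by simpa using hj)]
    exact ENNReal.div_lt_top ENNReal.ofReal_ne_top h0
  rw [ENNReal.div_lt_iff (Or.inl h0) (Or.inl htop), div_eq_mul_inv, mul_right_comm,
    ← div_eq_mul_inv, ENNReal.lt_div_iff_mul_lt (Or.inl hz) (Or.inl hjt)]
  calc ENNReal.ofReal (b k).2 * ratio p q (b j).1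
      ≤ ENNReal.ofReal (b k).2 * (m * ratio p q (b k).1) := by gcongr
    _ = ENNReal.ofReal (m * (b k).2) * ratio p q (b k).1 := by
        rw [ENNReal.ofReal_mul m.coe_nonneg, ENNReal.ofReal_coe_nnreal]; ring
    _ < ENNReal.ofReal (b j).2 * ratio p q (b k).1 :=
        ENNReal.mul_lt_mul_left h0 htop ((ENNReal.ofReal_lt_ofReal_iff hj).2 hlt)

variable [MeasurableSpace 𝒴]

theorem measurable_ratio {p q : 𝒴 → ℝ≥0} (hp : Measurable p) (hq : Measurable q) :
    Measurable (ratio p q) :=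
  hp.coe_nnreal_ennreal.div hq.coe_nnreal_ennreal

theorem measurable_score {p q : 𝒴 → ℝ≥0} (hp : Measurable p) (hq : Measurable q) (k : Fin N) :
    Measurable fun b : Fin N → 𝒴 × ℝ => score p q b k :=
  (measurable_pi_apply k).snd.ennreal_ofReal.div
    ((measurable_ratio hp hq).comp (measurable_pi_apply k).fst)

theorem measurable_zHat {p q : 𝒴 → ℝ≥0} (hp : Measurable p) (hq : Measurable q) :
    Measurable fun b : Fin N → 𝒴 × ℝ => zHat p q b :=
  Finset.measurable_sum _ fun k _ => (measurable_ratio hp hq).comp (measurable_pi_apply k).fst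

end Score

section Candidate

variable {𝒴 : Type*} {N : ℕ} [NeZero N]

theorem candidate_eq_iff (p q : 𝒴 → ℝ≥0) (b : Fin N → 𝒴 × ℝ) (k : Fin N) :
    candidate p q b = k ↔ (∀ j, score p q b k ≤ score p q b j) ∧
      ∀ i, (∀ j, score p q b i ≤ score p q b j) → k ≤ i := by
  unfold candidate
  rw [Finset.min'_eq_iff]
  simp

theorem candidate_eq_of_forall_lt (p q : 𝒴 → ℝ≥0) (b : Fin N → 𝒴 × ℝ) (k : Fin N)
    (h : ∀ j, j ≠ k → score p q b k < score p q b j) : candidate p q b = k := by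
  rw [candidate_eq_iff]
  refine ⟨fun j => ?_, fun i hi => ?_⟩
  · rcases eq_or_ne j k with rfl | hj
    · exact le_rfl
    · exact (h j hj).le
  · by_contra hik
    exact absurd (hi k) (not_le.2 (h i fun hh => hik hh.ge))

variable [MeasurableSpace 𝒴]

theorem measurable_candidate {p q : 𝒴 → ℝ≥0} (hp : Measurable p) (hq : Measurable q) :
    Measurable fun b : Fin N → 𝒴 × ℝ => candidate p q b := by
  refine measurable_to_countable' fun k => ?_
  have hle : ∀ i, MeasurableSet
      {b : Fin N → 𝒴 × ℝ | ∀ j, score p q b i ≤ score p q b j} := fun i => by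
    have : {b : Fin N → 𝒴 × ℝ | ∀ j, score p q b i ≤ score p q b j}
        = ⋂ j, {b | score p q b i ≤ score p q b j} := by ext; simp
    rw [this]
    exact MeasurableSet.iInter fun j =>
      measurableSet_le (measurable_score hp hq i) (measurable_score hp hq j)
  have : (fun b : Fin N → 𝒴 × ℝ => candidate p q b) ⁻¹' {k}
      = {b | ∀ j, score p q b k ≤ score p q b j} ∩
        ⋂ i, ({b | ∀ j, score p q b i ≤ score p q b j}ᶜ ∪ {_b | k ≤ i}) := by
    ext b
    simp [candidate_eq_iff, imp_iff_not_or]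
  rw [this]
  exact (hle k).inter (MeasurableSet.iInter fun i => (hle i).compl.union (MeasurableSet.const _))

/-- The point `Y_k` at the candidate `k` of a batch. -/
noncomputable def candidatePoint (p q : 𝒴 → ℝ≥0) (b : Fin N → 𝒴 × ℝ) : 𝒴 := (b (candidate p q b)).1

theorem measurable_candidate_comp {β : Type*} [MeasurableSpace β] {p q : 𝒴 → ℝ≥0}
    (hp : Measurable p) (hq : Measurable q) {f : Fin N → (Fin N → 𝒴 × ℝ) → β}
    (hf : ∀ k, Measurable (f k)) : Measurable fun b => f (candidate p q b) b := by
  have h : Measurable fun x : Fin N × (Fin N → 𝒴 × ℝ) => f x.1 x.2 :=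
    measurable_from_prod_countable_right fun k => hf k
  exact h.comp ((measurable_candidate hp hq).prodMk measurable_id)

theorem measurableSet_accepts {p q : 𝒴 → ℝ≥0} (hp : Measurable p) (hq : Measurable q)
    (ω : ℝ≥0∞) : MeasurableSet {e : Entry N 𝒴 | Accepts p q ω e} := by
  have h : Measurable fun b : Fin N → 𝒴 × ℝ => zHat p q b / zBar p q ω b (candidate p q b) :=
    measurable_candidate_comp hp hq (f := fun k b => zHat p q b / zBar p q ω b k) fun k =>
      (measurable_zHat hp hq).div
      (((measurable_zHat hp hq).add_const ω).sub
        ((measurable_ratio hp hq).comp (measurable_pi_apply k).fst))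
  exact measurableSet_le (f := fun e : Entry N 𝒴 => ENNReal.ofReal e.2)
    (g := fun e : Entry N 𝒴 => zHat p q e.1 / zBar p q ω e.1 (candidate p q e.1))
    measurable_snd.ennreal_ofReal (h.comp measurable_fst)

theorem measurable_candidatePoint {p q : 𝒴 → ℝ≥0} (hp : Measurable p) (hq : Measurable q) :
    Measurable fun b : Fin N → 𝒴 × ℝ => candidatePoint p q b :=
  measurable_candidate_comp hp hq (f := fun k b => (b k).1) fun k => (measurable_pi_apply k).fst

end Candidate

section CandidateLaw

variable {𝒴 : Type*} {n : ℕ}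

/-- The batch with points `y` and clocks `s`. -/
def zipBatch {N : ℕ} (y : Fin N → 𝒴) (s : Fin N → ℝ) : Fin N → 𝒴 × ℝ := fun i => (y i, s i)

/-- The weights `m j` only have to dominate the ratios `λ_j / λ_k`, so that a sum of the ratios for
two targets makes `k` the candidate of both. -/
theorem candidate_eq_of_race [NeZero (n + 1)] (p q : 𝒴 → ℝ≥0) (y : Fin (n + 1) → 𝒴)
    (k : Fin (n + 1)) (m : Fin n → ℝ≥0) (h0 : ratio p q (y k) ≠ 0) (htop : ratio p q (y k) ≠ ∞)
    (hm : ∀ j, ratio p q (y (k.succAbove j)) ≤ m j * ratio p q (y k)) (s : Fin (n + 1) → ℝ)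
    (hs : 0 < s k) (hlt : ∀ j, (m j : ℝ) * s k < s (k.succAbove j)) :
    candidate p q (zipBatch y s) = k := by
  refine candidate_eq_of_forall_lt _ _ _ _ fun i hi => ?_
  obtain ⟨j, rfl⟩ := Fin.exists_succAbove_eq hi
  exact score_lt_score p q (zipBatch y s) k _ (m j) h0 htop (hm j) hs (hlt j)

/-- Two targets share the candidate `k` with probability at least
`λA_k / (ẐA + r ẐB)`, where `r = λA_k / λB_k`. -/
theorem le_pi_candidate_eq_and_eq [NeZero (n + 1)] (pA pB q : 𝒴 → ℝ≥0) (y : Fin (n + 1) → 𝒴)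
    (k : Fin (n + 1)) (hA : ∀ j, ratio pA q (y j) ≠ ∞) (hB : ∀ j, ratio pB q (y j) ≠ ∞)
    (hA0 : ratio pA q (y k) ≠ 0) (hB0 : ratio pB q (y k) ≠ 0) :
    ratio pA q (y k) / (∑ j, ratio pA q (y j)
        + ratio pA q (y k) / ratio pB q (y k) * ∑ j, ratio pB q (y j))
      ≤ (Measure.pi fun _ : Fin (n + 1) => expMeasure 1)
        {s | candidate pA q (zipBatch y s) = k ∧ candidate pB q (zipBatch y s) = k} := by
  set a := ratio pA q (y k) with ha
  set b := ratio pB q (y k) with hb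
  have hm : ∀ j, ratio pA q (y j) / a + ratio pB q (y j) / b ≠ ∞ := fun j =>
    ENNReal.add_ne_top.2 ⟨ENNReal.div_ne_top (hA j) hA0, ENNReal.div_ne_top (hB j) hB0⟩
  let m : Fin n → ℝ≥0 := fun j =>
    (ratio pA q (y (k.succAbove j)) / a + ratio pB q (y (k.succAbove j)) / b).toNNReal
  have hmc : ∀ j, (m j : ℝ≥0∞)
      = ratio pA q (y (k.succAbove j)) / a + ratio pB q (y (k.succAbove j)) / b := fun j =>
    ENNReal.coe_toNNReal (hm _)
  refine le_trans ?_ (measure_mono (μ := Measure.pi fun _ : Fin (n + 1) => expMeasure 1)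
    (s := {s | 0 < s k ∧ ∀ j, (m j : ℝ) * s k < s (k.succAbove j)}) ?_)
  -- The race gives `(1 + Σ_{j ≠ k} m j)⁻¹`; adding one more `1 = a⁻¹ * (a / b * b)` for the
  -- index `k` of the second target turns the sum into the stated denominator.
  · rw [pi_expMeasure_race]
    simp only [hmc]
    have hinv : ∀ x, a / x = (a⁻¹ * x)⁻¹ := fun x => by
      rw [ENNReal.mul_inv (by simp [ha, hA]) (by simp [hA0]), inv_inv, div_eq_mul_inv]
    rw [hinv]
    apply ENNReal.inv_le_inv.2
    rw [Fin.sum_univ_succAbove _ k, Fin.sum_univ_succAbove _ k, ← ha, ← hb]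
    simp only [div_eq_mul_inv, Finset.sum_add_distrib, ← Finset.sum_mul]
    calc _ = a⁻¹ * a + ((∑ j, ratio pA q (y (k.succAbove j))) * a⁻¹
          + (a⁻¹ * a) * (∑ j, ratio pB q (y (k.succAbove j))) * b⁻¹) := by
            rw [ENNReal.inv_mul_cancel hA0 (hA k), one_mul]
      _ ≤ a⁻¹ * a + ((∑ j, ratio pA q (y (k.succAbove j))) * a⁻¹
          + (a⁻¹ * a) * (∑ j, ratio pB q (y (k.succAbove j))) * b⁻¹) + a⁻¹ * (a * b⁻¹ * b) :=
            le_self_add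
      _ = _ := by ring
  · rintro s ⟨hs, hlt⟩
    refine ⟨candidate_eq_of_race pA q y k m hA0 (hA k) (fun j => ?_) s hs hlt,
      candidate_eq_of_race pB q y k m hB0 (hB k) (fun j => ?_) s hs hlt⟩
    · rw [hmc, ← ha, add_mul, ENNReal.div_mul_cancel hA0 (hA k)]
      exact le_self_add
    · rw [hmc, ← hb, add_mul, ENNReal.div_mul_cancel hB0 (hB k)]
      exact le_add_self

theorem le_pi_candidate_eq [NeZero (n + 1)] (p q : 𝒴 → ℝ≥0) (y : Fin (n + 1) → 𝒴)
    (k : Fin (n + 1)) (hp : ∀ j, ratio p q (y j) ≠ ∞) :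
    ratio p q (y k) / ∑ j, ratio p q (y j)
      ≤ (Measure.pi fun _ : Fin (n + 1) => expMeasure 1)
        {s | candidate p q (zipBatch y s) = k} := by
  rcases eq_or_ne (ratio p q (y k)) 0 with h0 | h0
  · simp [h0]
  set a := ratio p q (y k) with ha
  let m : Fin n → ℝ≥0 := fun j => (ratio p q (y (k.succAbove j)) / a).toNNReal
  have hmc : ∀ j, (m j : ℝ≥0∞) = ratio p q (y (k.succAbove j)) / a := fun j =>
    ENNReal.coe_toNNReal (ENNReal.div_ne_top (hp _) h0)
  refine le_trans ?_ (measure_mono (μ := Measure.pi fun _ : Fin (n + 1) => expMeasure 1)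
    (s := {s | 0 < s k ∧ ∀ j, (m j : ℝ) * s k < s (k.succAbove j)}) ?_)
  · rw [pi_expMeasure_race]
    simp only [hmc]
    have hinv : ∀ x, a / x = (a⁻¹ * x)⁻¹ := fun x => by
      rw [ENNReal.mul_inv (by simp [ha, hp]) (by simp [h0]), inv_inv, div_eq_mul_inv]
    rw [hinv]
    apply ENNReal.inv_le_inv.2
    rw [Fin.sum_univ_succAbove _ k, ← ha]
    simp only [div_eq_mul_inv, ← Finset.sum_mul]
    rw [mul_add, ENNReal.inv_mul_cancel h0 (hp k), mul_comm a⁻¹]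
  · rintro s ⟨hs, hlt⟩
    refine candidate_eq_of_race p q y k m h0 (hp k) (fun j => ?_) s hs hlt
    rw [hmc, ← ha, ENNReal.div_mul_cancel h0 (hp k)]

/-- The lower bounds `λ_k / Ẑ` add up to one, so they are equalities. -/
theorem pi_candidate_eq [MeasurableSpace 𝒴] [NeZero (n + 1)] {p q : 𝒴 → ℝ≥0} (hpm : Measurable p)
    (hqm : Measurable q) (y : Fin (n + 1) → 𝒴) (k : Fin (n + 1))
    (hp : ∀ j, ratio p q (y j) ≠ ∞) (hZ : ∑ j, ratio p q (y j) ≠ 0) :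
    (Measure.pi fun _ : Fin (n + 1) => expMeasure 1) {s | candidate p q (zipBatch y s) = k}
      = ratio p q (y k) / ∑ j, ratio p q (y j) := by
  have hzip : Measurable fun s : Fin (n + 1) → ℝ => zipBatch y s :=
    measurable_pi_lambda _ fun i => measurable_const.prodMk (measurable_pi_apply i)
  have hsum : ∑ k, (Measure.pi fun _ : Fin (n + 1) => expMeasure 1)
      {s | candidate p q (zipBatch y s) = k} = 1 := by
    have := sum_measure_preimage_singleton
      (μ := Measure.pi fun _ : Fin (n + 1) => expMeasure 1) (Finset.univ : Finset (Fin (n + 1)))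
      (f := fun s => candidate p q (zipBatch y s)) fun k _ =>
        ((measurable_candidate hpm hqm).comp hzip) (measurableSet_singleton k)
    rw [show ((Finset.univ : Finset (Fin (n + 1))) : Set (Fin (n + 1))) = Set.univ by simp,
      Set.preimage_univ, measure_univ] at this
    exact this
  have hsum' : ∑ k, ratio p q (y k) / ∑ j, ratio p q (y j) = 1 := by
    simp only [div_eq_mul_inv, ← Finset.sum_mul]
    exact ENNReal.mul_inv_cancel hZ (ENNReal.sum_ne_top.2 fun j _ => hp j)
  refine le_antisymm ?_ (le_pi_candidate_eq p q y k hp)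
  by_contra hlt
  rw [not_le] at hlt
  have hle := Finset.sum_le_sum fun i (_ : i ∈ Finset.univ.erase k) => le_pi_candidate_eq p q y i hp
  rw [← Finset.add_sum_erase _ _ (Finset.mem_univ k)] at hsum hsum'
  have hne : ∑ i ∈ Finset.univ.erase k, ratio p q (y i) / ∑ j, ratio p q (y j) ≠ ∞ :=
    ne_top_of_le_ne_top ENNReal.one_ne_top (hsum' ▸ le_add_self)
  have := ENNReal.add_lt_add_of_lt_of_le hne hlt hle
  rw [hsum, hsum'] at this
  exact lt_irrefl _ this

end CandidateLaw

/-! ### Acceptance of a batch -/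

section Acceptance

variable {𝒴 : Type*}

theorem inv_one_add_div {z a : ℝ≥0∞} (h0 : z ≠ 0) (ht : z ≠ ∞) :
    (1 + a / z)⁻¹ = z / (z + a) := by
  have hinv : (z⁻¹ * (z + a))⁻¹ = z / (z + a) := by
    rw [ENNReal.mul_inv (Or.inl (by simp [ht])) (Or.inl (by simp [h0])), inv_inv, div_eq_mul_inv]
  rw [← hinv, mul_add, ENNReal.inv_mul_cancel h0 ht, div_eq_mul_inv, mul_comm a]

theorem zBar_zipBatch {n : ℕ} (p q : 𝒴 → ℝ≥0) (ω : ℝ≥0∞) (y : Fin (n + 1) → 𝒴)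
    (s : Fin (n + 1) → ℝ) (k : Fin (n + 1)) (hk : ratio p q (y k) ≠ ∞) :
    zBar p q ω (zipBatch y s) k = ∑ j, ratio p q (y (k.succAbove j)) + ω := by
  simp only [zBar, zHat, zipBatch]
  rw [Fin.sum_univ_succAbove _ k, add_assoc, ENNReal.add_sub_cancel_left hk]

/-- The reciprocal of a lower bound, relative to `λA(x)`, for the probability that both targets
accept a batch with the point `x` as their common candidate, where `z` are the other points. -/
noncomputable def couplingCost {n : ℕ} (pA pB q : 𝒴 → ℝ≥0) (ωA ωB : ℝ≥0∞) (x : 𝒴)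
    (z : Fin n → 𝒴) : ℝ≥0∞ :=
  ((ratio pA q x + ∑ j, ratio pA q (z j))
      + ratio pA q x / ratio pB q x * (ratio pB q x + ∑ j, ratio pB q (z j)))
    * (1 + (ωA - ratio pA q x) / (ratio pA q x + ∑ j, ratio pA q (z j))
      + (ωB - ratio pB q x) / (ratio pB q x + ∑ j, ratio pB q (z j)))

/-- Drawing the clocks independently of the uniform variable, both targets accept the candidate `k`
with probability at least `λA_k / couplingCost`. -/
theorem le_prod_candidate_accepts {n : ℕ} [NeZero (n + 1)] {pA pB q : 𝒴 → ℝ≥0}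
    {ωA ωB : ℝ≥0∞} (hωA : ωA ≠ ∞) (hωB : ωB ≠ ∞)
    (hpA : ∀ y, ratio pA q y ≤ ωA) (hpB : ∀ y, ratio pB q y ≤ ωB)
    (y : Fin (n + 1) → 𝒴) (k : Fin (n + 1)) (hA0 : ratio pA q (y k) ≠ 0)
    (hB0 : ratio pB q (y k) ≠ 0) :
    ratio pA q (y k) * (couplingCost pA pB q ωA ωB (y k) fun j => y (k.succAbove j))⁻¹
      ≤ ((Measure.pi fun _ : Fin (n + 1) => expMeasure 1).prod
      ((volume : Measure ℝ).restrict (Set.Ioo 0 1)))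
      ({s | candidate pA q (zipBatch y s) = k ∧ candidate pB q (zipBatch y s) = k} ×ˢ
        {u | ENNReal.ofReal u ≤ min
          ((∑ j, ratio pA q (y j)) / (∑ j, ratio pA q (y (k.succAbove j)) + ωA))
          ((∑ j, ratio pB q (y j)) / (∑ j, ratio pB q (y (k.succAbove j)) + ωB))}) := by
  have hAt : ∀ j, ratio pA q (y j) ≠ ∞ := fun j => ne_top_of_le_ne_top hωA (hpA _)
  have hBt : ∀ j, ratio pB q (y j) ≠ ∞ := fun j => ne_top_of_le_ne_top hωB (hpB _)
  have hrace := le_pi_candidate_eq_and_eq pA pB q y k hAt hBt hA0 hB0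
  have main : ∀ (p : 𝒴 → ℝ≥0) (ω : ℝ≥0∞), (∀ x, ratio p q x ≤ ω) → (∀ j, ratio p q (y j) ≠ ∞) →
      ratio p q (y k) ≠ 0 →
      (1 + (ω - ratio p q (y k)) / ∑ j, ratio p q (y j))⁻¹
        = (∑ j, ratio p q (y j)) / (∑ j, ratio p q (y (k.succAbove j)) + ω) := by
    intro p ω hp ht h0
    rw [inv_one_add_div _ (ENNReal.sum_ne_top.2 fun j _ => ht j)]
    · congr 1
      rw [Fin.sum_univ_succAbove _ k, add_right_comm, add_tsub_cancel_of_le (hp _), add_comm]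
    · rw [Fin.sum_univ_succAbove _ k]
      simp [h0]
  rw [Measure.prod_prod, volume_restrict_Ioo_ofReal_le]
  · rw [couplingCost, ← Fin.sum_univ_succAbove (fun j => ratio pA q (y j)) k,
      ← Fin.sum_univ_succAbove (fun j => ratio pB q (y j)) k, ENNReal.mul_inv, ← mul_assoc,
      ← div_eq_mul_inv]
    · refine mul_le_mul' hrace (le_min ?_ ?_)
      · rw [← main pA ωA hpA hAt hA0]
        exact ENNReal.inv_le_inv.2 le_self_add
      · rw [← main pB ωB hpB hBt hB0]
        refine ENNReal.inv_le_inv.2 ?_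
        rw [add_right_comm]
        exact le_self_add
    · right
      simp only [ne_eq, ENNReal.add_eq_top, ENNReal.one_ne_top, false_or, not_or]
      constructor <;> refine ENNReal.div_ne_top (ENNReal.sub_ne_top (by assumption)) ?_ <;>
      · rw [Fin.sum_univ_succAbove _ k]
        simp [hA0, hB0]
    · right
      simp
  · rw [← main pA ωA hpA hAt hA0]
    exact (min_le_left _ _).trans (ENNReal.inv_le_one.2 le_self_add)

end Acceptance

section EntryLaw

variable {𝒴 : Type*} [MeasurableSpace 𝒴]

instance isProbabilityMeasure_volume_restrict_Ioo :
    IsProbabilityMeasure ((volume : Measure ℝ).restrict (Set.Ioo 0 1)) := ⟨by simp⟩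

instance isProbabilityMeasure_entryLaw {N : ℕ} (Q : Measure 𝒴) [IsProbabilityMeasure Q] :
    IsProbabilityMeasure (entryLaw N Q) := by
  unfold entryLaw
  infer_instance

/-- Under the law of an entry, the points are drawn first, and then the clocks and the uniform
variable. -/
theorem entryLaw_apply {N : ℕ} (Q : Measure 𝒴) [IsProbabilityMeasure Q] {T : Set (Entry N 𝒴)}
    (hT : MeasurableSet T) :
    entryLaw N Q T = ∫⁻ y, ((Measure.pi fun _ : Fin N => expMeasure 1).prod
      ((volume : Measure ℝ).restrict (Set.Ioo 0 1))) {x | (zipBatch y x.1, x.2) ∈ T}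
      ∂(Measure.pi fun _ : Fin N => Q) := by
  have h1 := (measurePreserving_arrowProdEquivProdArrow 𝒴 ℝ (Fin N) (fun _ => Q)
    (fun _ => expMeasure 1)).symm
  have h2 := h1.prod (MeasurePreserving.id ((volume : Measure ℝ).restrict (Set.Ioo 0 1)))
  have h3 := (measurePreserving_prodAssoc (Measure.pi fun _ : Fin N => Q)
    (Measure.pi fun _ : Fin N => expMeasure 1)
    ((volume : Measure ℝ).restrict (Set.Ioo 0 1))).symm
  have h4 := h2.comp h3
  rw [entryLaw, ← h4.measure_preimage hT.nullMeasurableSet,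
    Measure.prod_apply (h4.measurable hT)]
  rfl

theorem lintegral_pi_succAbove {n : ℕ} (Q : Measure 𝒴) [IsProbabilityMeasure Q] (k : Fin (n + 1))
    {F : 𝒴 → (Fin n → 𝒴) → ℝ≥0∞} (hF : Measurable (Function.uncurry F)) :
    ∫⁻ y, F (y k) (fun j => y (k.succAbove j)) ∂(Measure.pi fun _ : Fin (n + 1) => Q)
      = ∫⁻ x, ∫⁻ z, F x z ∂(Measure.pi fun _ : Fin n => Q) ∂Q := by
  have hmp := measurePreserving_piFinSuccAbove (fun _ : Fin (n + 1) => Q) k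
  rw [← lintegral_prod (fun p : 𝒴 × (Fin n → 𝒴) => F p.1 p.2) hF.aemeasurable]
  exact hmp.lintegral_comp hF

theorem measure_eq_sum_inter_preimage_singleton {α : Type*} [MeasurableSpace α] {N : ℕ}
    (P : Measure α) (T : Set α) {f : α → Fin N} (hf : Measurable f) :
    P T = ∑ k, P (f ⁻¹' {k} ∩ T) := by
  have h := sum_measure_preimage_singleton (μ := P.restrict T) (Finset.univ : Finset (Fin N))
    (f := f) fun k _ => hf (measurableSet_singleton k)
  rw [Finset.coe_univ, Set.preimage_univ, Measure.restrict_apply_univ] at h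
  rw [← h]
  exact Finset.sum_congr rfl fun k _ => Measure.restrict_apply (hf (measurableSet_singleton k))

theorem prod_candidate_accepts {n : ℕ} [NeZero (n + 1)] {p q : 𝒴 → ℝ≥0} (hpm : Measurable p)
    (hqm : Measurable q) {ω : ℝ≥0∞} (hω : ω ≠ ∞) (hp : ∀ y, ratio p q y ≤ ω)
    (y : Fin (n + 1) → 𝒴) (k : Fin (n + 1)) :
    ((Measure.pi fun _ : Fin (n + 1) => expMeasure 1).prod
      ((volume : Measure ℝ).restrict (Set.Ioo 0 1)))
      ({s | candidate p q (zipBatch y s) = k} ×ˢ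
        {u | ENNReal.ofReal u ≤ (∑ j, ratio p q (y j)) /
          (∑ j, ratio p q (y (k.succAbove j)) + ω)})
      = ratio p q (y k) * (∑ j, ratio p q (y (k.succAbove j)) + ω)⁻¹ := by
  have hfin : ∀ j, ratio p q (y j) ≠ ∞ := fun j => ne_top_of_le_ne_top hω (hp _)
  rw [Measure.prod_prod, volume_restrict_Ioo_ofReal_le]
  · rcases eq_or_ne (∑ j, ratio p q (y j)) 0 with h0 | h0
    -- If all ratios vanish the candidate is arbitrary, but the batch is almost surely rejected.
    · have hk : ratio p q (y k) = 0 := (Finset.sum_eq_zero_iff.1 h0) k (Finset.mem_univ k)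
      rw [h0, hk]
      simp
    · rw [pi_candidate_eq hpm hqm y k hfin h0, div_eq_mul_inv, div_eq_mul_inv, mul_assoc,
        ← mul_assoc (∑ j, ratio p q (y j))⁻¹,
        ENNReal.inv_mul_cancel h0 (ENNReal.sum_ne_top.2 fun j _ => hfin j), one_mul]
  · refine ENNReal.div_le_of_le_mul ?_
    rw [one_mul, Fin.sum_univ_succAbove _ k, add_comm]
    gcongr
    exact hp _

/-- The event that a batch is accepted and that its candidate lies in `D` has probability
proportional to the mass which the target gives to `D`. -/
theorem entryLaw_accepts_and_mem {n : ℕ} [NeZero (n + 1)] {p q : 𝒴 → ℝ≥0} (hpm : Measurable p)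
    (hqm : Measurable q) {ω : ℝ≥0∞} (hω : ω ≠ ∞) (hp : ∀ y, ratio p q y ≤ ω)
    (Q : Measure 𝒴) [IsProbabilityMeasure Q] {D : Set 𝒴} (hD : MeasurableSet D) :
    entryLaw (n + 1) Q {e | Accepts p q ω e ∧ candidatePoint p q e.1 ∈ D}
      = (∫⁻ y in D, ratio p q y ∂Q) * ((n + 1 : ℕ) *
        ∫⁻ z, (∑ j, ratio p q (z j) + ω)⁻¹ ∂(Measure.pi fun _ : Fin n => Q)) := by
  have hTm : MeasurableSet
      {e : Entry (n + 1) 𝒴 | Accepts p q ω e ∧ candidatePoint p q e.1 ∈ D} :=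
    (measurableSet_accepts hpm hqm ω).inter
      (((measurable_candidatePoint hpm hqm).comp measurable_fst) hD)
  have hcm : Measurable fun e : Entry (n + 1) 𝒴 => candidate p q e.1 :=
    (measurable_candidate hpm hqm).comp measurable_fst
  have hrm := measurable_ratio hpm hqm
  have hSm : Measurable fun z : Fin n → 𝒴 => (∑ j, ratio p q (z j) + ω)⁻¹ :=
    ((Finset.measurable_sum _ fun j _ => hrm.comp (measurable_pi_apply j)).add_const ω).inv
  rw [measure_eq_sum_inter_preimage_singleton (entryLaw (n + 1) Q) _ hcm]
  have hk : ∀ k : Fin (n + 1), entryLaw (n + 1) Q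
      ((fun e : Entry (n + 1) 𝒴 => candidate p q e.1) ⁻¹' {k} ∩
        {e | Accepts p q ω e ∧ candidatePoint p q e.1 ∈ D})
      = (∫⁻ y in D, ratio p q y ∂Q) *
        ∫⁻ z, (∑ j, ratio p q (z j) + ω)⁻¹ ∂(Measure.pi fun _ : Fin n => Q) := by
    intro k
    rw [entryLaw_apply Q ((hcm (measurableSet_singleton k)).inter hTm)]
    have hy : ∀ y : Fin (n + 1) → 𝒴, ((Measure.pi fun _ : Fin (n + 1) => expMeasure 1).prod
        ((volume : Measure ℝ).restrict (Set.Ioo 0 1)))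
        {x | (zipBatch y x.1, x.2) ∈ (fun e : Entry (n + 1) 𝒴 => candidate p q e.1) ⁻¹' {k} ∩
          {e | Accepts p q ω e ∧ candidatePoint p q e.1 ∈ D}}
        = D.indicator (ratio p q) (y k) * (∑ j, ratio p q (y (k.succAbove j)) + ω)⁻¹ := by
      intro y
      by_cases hyD : y k ∈ D
      · rw [Set.indicator_of_mem hyD, ← prod_candidate_accepts hpm hqm hω hp y k]
        congr 1
        ext x
        simp only [Set.mem_ofPred_eq, Set.mem_inter_iff, Set.mem_preimage, Set.mem_singleton_iff,
          Set.mem_prod]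
        refine and_congr_right fun hc => ?_
        simp only [Accepts, candidatePoint, hc]
        rw [zBar_zipBatch _ _ _ _ _ _ (ne_top_of_le_ne_top hω (hp _))]
        exact and_iff_left hyD
      · rw [Set.indicator_of_notMem hyD, zero_mul]
        convert measure_empty (μ := ((Measure.pi fun _ : Fin (n + 1) => expMeasure 1).prod
          ((volume : Measure ℝ).restrict (Set.Ioo 0 1))))
        ext x
        simp only [Set.mem_ofPred_eq, Set.mem_inter_iff, Set.mem_preimage, Set.mem_singleton_iff,
          Set.mem_empty_iff_false, iff_false]
        rintro ⟨hc, -, hd⟩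
        simp only [candidatePoint, hc] at hd
        exact hyD hd
    rw [lintegral_congr hy, lintegral_pi_succAbove Q k
      (F := fun x z => D.indicator (ratio p q) x * (∑ j, ratio p q (z j) + ω)⁻¹)
      (((hrm.indicator hD).comp measurable_fst).mul (hSm.comp measurable_snd))]
    simp only [lintegral_const_mul _ hSm]
    rw [lintegral_mul_const _ (hrm.indicator hD), lintegral_indicator hD]
  simp only [hk, Finset.sum_const, Finset.card_univ, Fintype.card_fin, nsmul_eq_mul]
  ring

theorem measurable_couplingCost {n : ℕ} {pA pB q : 𝒴 → ℝ≥0} (hpA : Measurable pA)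
    (hpB : Measurable pB) (hq : Measurable q) (ωA ωB : ℝ≥0∞) :
    Measurable (Function.uncurry (couplingCost (n := n) pA pB q ωA ωB)) := by
  have hA := measurable_ratio hpA hq
  have hB := measurable_ratio hpB hq
  have hx : ∀ {f : 𝒴 → ℝ≥0∞}, Measurable f → Measurable fun v : 𝒴 × (Fin n → 𝒴) => f v.1 :=
    fun hf => hf.comp measurable_fst
  have hz : ∀ {f : 𝒴 → ℝ≥0∞}, Measurable f →
      Measurable fun v : 𝒴 × (Fin n → 𝒴) => f v.1 + ∑ j, f (v.2 j) := fun hf =>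
    (hx hf).add (Finset.measurable_sum _ fun j _ =>
      hf.comp ((measurable_pi_apply j).comp measurable_snd))
  exact ((hz hA).add (((hx hA).div (hx hB)).mul (hz hB))).mul
    ((measurable_const.add ((measurable_const.sub (hx hA)).div (hz hA))).add
      ((measurable_const.sub (hx hB)).div (hz hB)))

/-- The event that both targets accept an entry, with the same candidate, whose point lies in
`D`. -/
def matchedIn {N : ℕ} [NeZero N] (pA pB q : 𝒴 → ℝ≥0) (ωA ωB : ℝ≥0∞) (D : Set 𝒴) :
    Set (Entry N 𝒴) :=
  {e | (Accepts pA q ωA e ∧ Accepts pB q ωB e) ∧ candidate pA q e.1 = candidate pB q e.1 ∧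
    candidatePoint pA q e.1 ∈ D}

theorem measurableSet_matchedIn {N : ℕ} [NeZero N] {pA pB q : 𝒴 → ℝ≥0} (hpA : Measurable pA)
    (hpB : Measurable pB) (hq : Measurable q) (ωA ωB : ℝ≥0∞) {D : Set 𝒴} (hD : MeasurableSet D) :
    MeasurableSet (matchedIn (N := N) pA pB q ωA ωB D) :=
  ((measurableSet_accepts hpA hq ωA).inter (measurableSet_accepts hpB hq ωB)).inter
    ((measurableSet_eq_fun ((measurable_candidate hpA hq).comp measurable_fst)
      ((measurable_candidate hpB hq).comp measurable_fst)).inter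
      (((measurable_candidatePoint hpA hq).comp measurable_fst) hD))

theorem le_entryLaw_matchedIn {n : ℕ} [NeZero (n + 1)] {pA pB q : 𝒴 → ℝ≥0}
    (hpAm : Measurable pA) (hpBm : Measurable pB) (hqm : Measurable q)
    {ωA ωB : ℝ≥0∞} (hωA : ωA ≠ ∞) (hωB : ωB ≠ ∞)
    (hpA : ∀ y, ratio pA q y ≤ ωA) (hpB : ∀ y, ratio pB q y ≤ ωB)
    (Q : Measure 𝒴) [IsProbabilityMeasure Q] {D : Set 𝒴} (hD : MeasurableSet D)
    (hD0 : ∀ x ∈ D, ratio pA q x ≠ 0 ∧ ratio pB q x ≠ 0) :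
    ∫⁻ x in D, ratio pA q x * ((n + 1 : ℕ) * ∫⁻ z, (couplingCost pA pB q ωA ωB x z)⁻¹
        ∂(Measure.pi fun _ : Fin n => Q)) ∂Q
      ≤ entryLaw (n + 1) Q (matchedIn pA pB q ωA ωB D) := by
  have hTm := measurableSet_matchedIn (N := n + 1) hpAm hpBm hqm ωA ωB hD
  have hcm : Measurable fun e : Entry (n + 1) 𝒴 => candidate pA q e.1 :=
    (measurable_candidate hpAm hqm).comp measurable_fst
  have hrm := measurable_ratio hpAm hqm
  have hcost := measurable_couplingCost (n := n) hpAm hpBm hqm ωA ωB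
  rw [measure_eq_sum_inter_preimage_singleton (entryLaw (n + 1) Q) _ hcm]
  have hk : ∀ k : Fin (n + 1),
      ∫⁻ x, D.indicator (ratio pA q) x * ∫⁻ z, (couplingCost pA pB q ωA ωB x z)⁻¹
        ∂(Measure.pi fun _ : Fin n => Q) ∂Q ≤ entryLaw (n + 1) Q
      ((fun e : Entry (n + 1) 𝒴 => candidate pA q e.1) ⁻¹' {k} ∩
        matchedIn pA pB q ωA ωB D) := by
    intro k
    rw [entryLaw_apply Q ((hcm (measurableSet_singleton k)).inter hTm)]
    have hsec : ∀ x, Measurable fun z : Fin n → 𝒴 => (couplingCost pA pB q ωA ωB x z)⁻¹ :=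
      fun x => (hcost.comp measurable_prodMk_left).inv
    simp_rw [← lintegral_const_mul _ (hsec _)]
    rw [← lintegral_pi_succAbove Q k
      (F := fun x z => D.indicator (ratio pA q) x * (couplingCost pA pB q ωA ωB x z)⁻¹)
      (((hrm.indicator hD).comp measurable_fst).mul hcost.inv)]
    refine lintegral_mono fun y => ?_
    by_cases hyD : y k ∈ D
    · simp only [Set.indicator_of_mem hyD]
      refine (le_prod_candidate_accepts hωA hωB hpA hpB y k (hD0 _ hyD).1 (hD0 _ hyD).2).trans
        (measure_mono ?_)
      rintro ⟨s, u⟩ ⟨⟨hcA, hcB⟩, hu⟩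
      have hu := le_min_iff.1 (show ENNReal.ofReal u ≤ min _ _ from hu)
      refine ⟨hcA, ⟨?_, ?_⟩, hcA.trans hcB.symm, ?_⟩
      · simp only [Accepts, hcA]
        rw [zBar_zipBatch _ _ _ _ _ _ (ne_top_of_le_ne_top hωA (hpA _))]
        exact hu.1
      · simp only [Accepts, hcB]
        rw [zBar_zipBatch _ _ _ _ _ _ (ne_top_of_le_ne_top hωB (hpB _))]
        exact hu.2
      · simp only [candidatePoint, hcA]
        exact hyD
    · simp [Set.indicator_of_notMem hyD]
  have hind : ∀ x, D.indicator (fun x => ratio pA q x * ((n + 1 : ℕ) *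
        ∫⁻ z, (couplingCost pA pB q ωA ωB x z)⁻¹ ∂(Measure.pi fun _ : Fin n => Q))) x
      = (n + 1 : ℕ) * (D.indicator (ratio pA q) x * ∫⁻ z, (couplingCost pA pB q ωA ωB x z)⁻¹
        ∂(Measure.pi fun _ : Fin n => Q)) := by
    intro x
    by_cases hx : x ∈ D
    · simp only [Set.indicator_of_mem hx]
      ring
    · simp [Set.indicator_of_notMem hx]
  rw [← lintegral_indicator hD, lintegral_congr hind, lintegral_const_mul' _ _ (by simp)]
  refine le_trans ?_ (Finset.sum_le_sum fun k _ => hk k)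
  simp

end EntryLaw

/-! ### The sampler on an i.i.d. sequence of entries -/

section Law

variable {𝒴 : Type*} {N : ℕ} [MeasurableSpace 𝒴]
  {Ω : Type*} [MeasurableSpace Ω] {μ : Measure Ω} {Q : Measure 𝒴} {W : ℕ → Ω → Entry N 𝒴}

theorem IsCommonRandomness.aemeasurable (hW : IsCommonRandomness μ Q W) :
    AEMeasurable (fun o i => W i o) μ :=
  aemeasurable_pi_lambda _ fun i => (hW.hasLaw i).aemeasurable

theorem IsCommonRandomness.measure_preimage (hW : IsCommonRandomness μ Q W) (i : ℕ)
    {s : Set (Entry N 𝒴)} (hs : MeasurableSet s) : μ (W i ⁻¹' s) = entryLaw N Q s := by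
  rw [← (hW.hasLaw i).map_eq, Measure.map_apply_of_aemeasurable (hW.hasLaw i).aemeasurable hs]

/-- The law of the first entry in `A`, by summing a geometric series. -/
theorem IsCommonRandomness.measure_first_mem (hW : IsCommonRandomness μ Q W)
    [IsProbabilityMeasure Q] {A G : Set (Entry N 𝒴)} (hA : MeasurableSet A)
    (hG : MeasurableSet G) (hGA : G ⊆ A) :
    μ {o | ∃ i, W i o ∈ G ∧ ∀ j < i, W j o ∉ A}
      = (entryLaw N Q A)⁻¹ * entryLaw N Q G := by
  -- `E i` is the event that the entry `i` is the first in `A` and lies in `G`, written as a finite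
  -- intersection of independent events.
  let S : ℕ → ℕ → Set (Entry N 𝒴) := fun i j => if j = i then G else Aᶜ
  have hS : ∀ i j, MeasurableSet (S i j) := fun i j => by
    by_cases h : j = i <;> simp [S, h, hG, hA.compl]
  let E : ℕ → Set Ω := fun i => ⋂ j ∈ Finset.range (i + 1), W j ⁻¹' S i j
  have hmem : ∀ i o, o ∈ E i ↔ W i o ∈ G ∧ ∀ j < i, W j o ∉ A := by
    intro i o
    simp only [E, S, Set.mem_iInter, Finset.mem_range, Set.mem_preimage]
    constructor
    · intro h
      refine ⟨by simpa using h i (by simp), fun j hj => ?_⟩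
      have := h j (by omega)
      rw [if_neg hj.ne] at this
      exact this
    · rintro ⟨h1, h2⟩ j hj
      split_ifs with hji
      · exact hji ▸ h1
      · exact h2 j (by omega)
  have hE : {o | ∃ i, W i o ∈ G ∧ ∀ j < i, W j o ∉ A} = ⋃ i, E i := by
    ext o
    simp only [Set.mem_ofPred_eq, Set.mem_iUnion, hmem]
  have hdisj : Pairwise (Function.onFun (AEDisjoint μ) E) := by
    intro i j hij
    refine Disjoint.aedisjoint (Set.disjoint_left.2 fun o hi hj => ?_)
    rw [hmem] at hi hj
    rcases lt_or_gt_of_ne hij with h | h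
    · exact hj.2 i h (hGA hi.1)
    · exact hi.2 j h (hGA hj.1)
  have hnull : ∀ i, NullMeasurableSet (E i) μ := fun i =>
    NullMeasurableSet.biInter (Finset.range (i + 1)).countable_toSet fun j _ =>
      (hW.hasLaw j).aemeasurable.nullMeasurableSet_preimage (hS i j)
  have hmeas : ∀ i, μ (E i) = (1 - entryLaw N Q A) ^ i * entryLaw N Q G := by
    intro i
    rw [hW.indep.measure_inter_preimage_eq_mul (Finset.range (i + 1)) fun j _ => hS i j,
      Finset.prod_range_succ, hW.measure_preimage i (hS i i)]
    congr 1
    · rw [Finset.prod_congr rfl (g := fun _ => 1 - entryLaw N Q A), Finset.prod_const,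
        Finset.card_range]
      intro j hj
      rw [hW.measure_preimage j (hS i j), ← prob_compl_eq_one_sub hA]
      simp only [S, if_neg (Finset.mem_range.1 hj).ne]
    · simp [S]
  rw [hE, measure_iUnion₀ hdisj hnull]
  simp_rw [hmeas]
  rw [ENNReal.tsum_mul_right, ENNReal.tsum_geometric,
    ENNReal.sub_sub_cancel ENNReal.one_ne_top prob_le_one]

end Law

section Sampler

variable {𝒴 : Type*} {N : ℕ} [NeZero N]

theorem ers_of_first (p q : 𝒴 → ℝ≥0) (ω : ℝ≥0∞) (w : ℕ → Entry N 𝒴) (i : ℕ)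
    (hi : Accepts p q ω (w i)) (hlt : ∀ j < i, ¬ Accepts p q ω (w j)) :
    ers p q ω w = (i, candidate p q (w i).1) := by
  have : sInf {i | Accepts p q ω (w i)} = i := by
    refine le_antisymm (Nat.sInf_le hi) ?_
    by_contra hh
    exact hlt _ (not_le.1 hh) (Nat.sInf_mem (s := {i | Accepts p q ω (w i)}) ⟨i, hi⟩)
  simp only [ers, this]

/-- The output of the sampler run on a sequence of entries. -/
noncomputable def ersSample (p q : 𝒴 → ℝ≥0) (ω : ℝ≥0∞) (w : ℕ → Entry N 𝒴) : 𝒴 :=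
  sampleAt w (ers p q ω w)

variable [MeasurableSpace 𝒴]

theorem measurable_sInf_accepts {p q : 𝒴 → ℝ≥0} (hp : Measurable p) (hq : Measurable q)
    (ω : ℝ≥0∞) : Measurable fun w : ℕ → Entry N 𝒴 => sInf {i | Accepts p q ω (w i)} := by
  have hacc : ∀ i, MeasurableSet {w : ℕ → Entry N 𝒴 | Accepts p q ω (w i)} := fun i =>
    measurableSet_preimage (f := fun w : ℕ → Entry N 𝒴 => w i) (measurable_pi_apply i)
      (measurableSet_accepts hp hq ω)
  refine measurable_to_countable' fun i => ?_
  have : (fun w : ℕ → Entry N 𝒴 => sInf {i | Accepts p q ω (w i)}) ⁻¹' {i}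
      = ({w | Accepts p q ω (w i)} ∩ ⋂ j, ⋂ (_ : j < i), {w | Accepts p q ω (w j)}ᶜ)
        ∪ ({_w | i = 0} ∩ ⋂ j, {w | Accepts p q ω (w j)}ᶜ) := by
    ext w
    simp only [Set.mem_preimage, Set.mem_singleton_iff, Set.mem_union, Set.mem_inter_iff,
      Set.mem_ofPred_eq, Set.mem_iInter, Set.mem_compl_iff]
    constructor
    · rintro rfl
      by_cases hne : ∃ j, Accepts p q ω (w j)
      · exact Or.inl ⟨Nat.sInf_mem (s := {i | Accepts p q ω (w i)}) hne,
          fun j hj => Nat.notMem_of_lt_sInf hj⟩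
      · rw [not_exists] at hne
        exact Or.inr ⟨by simp [hne], hne⟩
    · rintro (⟨h1, h2⟩ | ⟨rfl, h2⟩)
      · have := ers_of_first p q ω w i h1 h2
        exact congrArg Prod.fst this
      · simp [h2]
  rw [this]
  exact ((hacc i).inter (MeasurableSet.iInter fun j => MeasurableSet.iInter fun _ =>
    (hacc j).compl)).union ((MeasurableSet.const _).inter
      (MeasurableSet.iInter fun j => (hacc j).compl))

theorem measurable_ersSample {p q : 𝒴 → ℝ≥0} (hp : Measurable p) (hq : Measurable q)
    (ω : ℝ≥0∞) : Measurable fun w : ℕ → Entry N 𝒴 => ersSample p q ω w := by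
  have h : Measurable fun x : ℕ × (ℕ → Entry N 𝒴) => candidatePoint p q (x.2 x.1).1 :=
    measurable_from_prod_countable_right fun i =>
      (measurable_candidatePoint hp hq).comp (measurable_pi_apply i).fst
  exact h.comp ((measurable_sInf_accepts hp hq ω).prodMk measurable_id)

end Sampler

/-- Ensemble rejection sampling is exact: given acceptance, the candidate of a batch has the target
as its law, and the first accepted batch inherits this. -/
theorem IsCommonRandomness.map_ersSample {𝒴 : Type*} [MeasurableSpace 𝒴] {n : ℕ}
    [NeZero (n + 1)] {Ω : Type*} [MeasurableSpace Ω] {μ : Measure Ω} [IsProbabilityMeasure μ]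
    {Q : Measure 𝒴} [IsProbabilityMeasure Q] {W : ℕ → Ω → Entry (n + 1) 𝒴}
    (hW : IsCommonRandomness μ Q W) {p q : 𝒴 → ℝ≥0} (hpm : Measurable p)
    (hqm : Measurable q) {ω : ℝ≥0∞} (hω : ω ≠ ∞) (hp : ∀ y, ratio p q y ≤ ω)
    [IsProbabilityMeasure (Q.withDensity (ratio p q))] :
    μ.map (fun o => ersSample p q ω fun i => W i o) = Q.withDensity (ratio p q) := by
  have hae : AEMeasurable (fun o => ersSample p q ω fun i => W i o) μ :=
    (measurable_ersSample hpm hqm ω).comp_aemeasurable hW.aemeasurable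
  have : IsProbabilityMeasure (μ.map fun o => ersSample p q ω fun i => W i o) :=
    Measure.isProbabilityMeasure_map hae
  -- Both measures have mass one, so it is enough to bound the law from below, and the event that
  -- no batch is accepted can be ignored.
  symm
  refine Measure.eq_of_le_of_isProbabilityMeasure (Measure.le_iff.2 fun D hD => ?_)
  set c : ℝ≥0∞ := (n + 1 : ℕ) *
    ∫⁻ z, (∑ j, ratio p q (z j) + ω)⁻¹ ∂(Measure.pi fun _ : Fin n => Q) with hc
  have hG : ∀ {D}, MeasurableSet D →
      entryLaw (n + 1) Q {e | Accepts p q ω e ∧ candidatePoint p q e.1 ∈ D}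
        = Q.withDensity (ratio p q) D * c := fun hD => by
    rw [entryLaw_accepts_and_mem hpm hqm hω hp Q hD, withDensity_apply _ hD]
  have hA : entryLaw (n + 1) Q {e | Accepts p q ω e} = c := by
    have := hG MeasurableSet.univ
    rw [measure_univ, one_mul] at this
    simpa using this
  have hct : c ≠ ∞ := hA ▸ measure_ne_top _ _
  have hc0 : c ≠ 0 := by
    have hle : (∑ _j : Fin n, ω + ω)⁻¹
        ≤ ∫⁻ z, (∑ j, ratio p q (z j) + ω)⁻¹ ∂(Measure.pi fun _ : Fin n => Q) := by
      calc (∑ _j : Fin n, ω + ω)⁻¹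
          = ∫⁻ _, (∑ _j : Fin n, ω + ω)⁻¹ ∂(Measure.pi fun _ : Fin n => Q) := by simp
        _ ≤ _ := lintegral_mono fun z => ENNReal.inv_le_inv.2 (by gcongr; exact hp _)
    have hpos : (∑ _j : Fin n, ω + ω)⁻¹ ≠ 0 :=
      ENNReal.inv_ne_zero.2 (ENNReal.add_ne_top.2 ⟨ENNReal.sum_ne_top.2 fun _ _ => hω, hω⟩)
    exact mul_ne_zero (by simp) (fun h => hpos (le_zero_iff.1 (h ▸ hle)))
  have hfirst := hW.measure_first_mem (measurableSet_accepts hpm hqm ω)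
    (G := {e | Accepts p q ω e ∧ candidatePoint p q e.1 ∈ D})
    ((measurableSet_accepts hpm hqm ω).inter
      (((measurable_candidatePoint hpm hqm).comp measurable_fst) hD)) fun e he => he.1
  rw [hA, hG hD, mul_comm, mul_assoc, ENNReal.mul_inv_cancel hc0 hct, mul_one] at hfirst
  rw [← hfirst, Measure.map_apply_of_aemeasurable hae hD]
  refine measure_mono ?_
  rintro o ⟨i, ⟨hacc, hmem⟩, hlt⟩
  simp only [Set.mem_preimage, ersSample]
  rw [ers_of_first p q ω _ i hacc hlt]
  exact hmem

/-- If both targets accept the first entry with the same candidate, the outputs agree. -/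
theorem IsCommonRandomness.entryLaw_matchedIn_le {𝒴 : Type*} [MeasurableSpace 𝒴] {N : ℕ}
    [NeZero N] {Ω : Type*} [MeasurableSpace Ω] {μ : Measure Ω}
    {Q : Measure 𝒴} {W : ℕ → Ω → Entry N 𝒴}
    (hW : IsCommonRandomness μ Q W) {pA pB q : 𝒴 → ℝ≥0} (hpA : Measurable pA)
    (hpB : Measurable pB) (hq : Measurable q) (ωA ωB : ℝ≥0∞) {D : Set 𝒴}
    (hD : MeasurableSet D) :
    entryLaw N Q (matchedIn pA pB q ωA ωB D) ≤
      μ {o | ersSample pA q ωA (fun i => W i o) ∈ D ∧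
        ersSample pA q ωA (fun i => W i o) = ersSample pB q ωB (fun i => W i o)} := by
  rw [← hW.measure_preimage 0 (measurableSet_matchedIn hpA hpB hq ωA ωB hD)]
  refine measure_mono ?_
  rintro o ⟨⟨hA, hB⟩, hcand, hmem⟩
  have h1 := ers_of_first pA q ωA (fun i => W i o) 0 hA fun j hj => absurd hj (Nat.not_lt_zero j)
  have h2 := ers_of_first pB q ωB (fun i => W i o) 0 hB fun j hj => absurd hj (Nat.not_lt_zero j)
  simp only [Set.mem_ofPred_eq, ersSample, h1, h2, hcand, and_true]
  rw [← hcand]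
  exact hmem

/-! ### The mean cost of a match and the coefficients -/

section Moments

variable {𝒴 : Type*} [MeasurableSpace 𝒴] (Q : Measure 𝒴) [IsProbabilityMeasure Q]

theorem lintegral_pi_eval {m : ℕ} (j : Fin m) {h : 𝒴 → ℝ≥0∞} (hh : Measurable h) :
    ∫⁻ z, h (z j) ∂(Measure.pi fun _ : Fin m => Q) = ∫⁻ y, h y ∂Q :=
  (measurePreserving_eval (fun _ : Fin m => Q) j).lintegral_comp hh

theorem measurable_sum_eval {m : ℕ} {h : 𝒴 → ℝ≥0∞} (hh : Measurable h) :
    Measurable fun z : Fin m → 𝒴 => ∑ j, h (z j) :=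
  Finset.measurable_sum _ fun j _ => hh.comp (measurable_pi_apply j)

theorem lintegral_pi_sum {m : ℕ} {h : 𝒴 → ℝ≥0∞} (hh : Measurable h) :
    ∫⁻ z, ∑ j, h (z j) ∂(Measure.pi fun _ : Fin m => Q) = m * ∫⁻ y, h y ∂Q := by
  have hj : ∀ j, Measurable fun z : Fin m → 𝒴 => h (z j) := fun j =>
    hh.comp (measurable_pi_apply j)
  rw [lintegral_finsetSum _ fun j _ => hj j]
  simp only [lintegral_pi_eval Q _ hh]
  simp

theorem lintegral_inv_sum_le {m : ℕ} (hm : m ≠ 0) {g : 𝒴 → ℝ≥0∞} (hg : Measurable g) :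
    ∫⁻ z, (∑ j, g (z j))⁻¹ ∂(Measure.pi fun _ : Fin m => Q)
      ≤ (m : ℝ≥0∞)⁻¹ * ∫⁻ y, (g y)⁻¹ ∂Q := by
  have hm0 : (m : ℝ≥0∞) ≠ 0 := by exact_mod_cast hm
  calc ∫⁻ z, (∑ j, g (z j))⁻¹ ∂(Measure.pi fun _ : Fin m => Q)
      ≤ ∫⁻ z, (m : ℝ≥0∞)⁻¹ * ((m : ℝ≥0∞)⁻¹ * ∑ j, (g (z j))⁻¹)
          ∂(Measure.pi fun _ : Fin m => Q) :=
        lintegral_mono fun z => inv_sum_le_sum_inv hm fun j => g (z j)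
    _ = (m : ℝ≥0∞)⁻¹ * ∫⁻ y, (g y)⁻¹ ∂Q := by
        rw [lintegral_const_mul' _ _ (by simp [hm]), lintegral_const_mul' _ _ (by simp [hm]),
          lintegral_pi_sum Q (h := fun y => (g y)⁻¹) hg.inv,
          ← mul_assoc (m : ℝ≥0∞)⁻¹ (m : ℝ≥0∞),
          ENNReal.inv_mul_cancel hm0 (ENNReal.natCast_ne_top m), one_mul]

/-- Leaving `z j` out of the denominator makes it independent of the numerator; for a single point
this is impossible, and `f ≤ ω` is used instead. -/
theorem sum_lintegral_div_sum_le {n : ℕ} (hn : n ≠ 0) {f g : 𝒴 → ℝ≥0∞} (hf : Measurable f)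
    (hg : Measurable g) {ω : ℝ≥0∞} (hω : ω ≠ ∞) (hfω : ∀ y, f y ≤ ω) (hf1 : ∫⁻ y, f y ∂Q = 1) :
    ∑ j, ∫⁻ z, f (z j) * (∑ l, g (z l))⁻¹ ∂(Measure.pi fun _ : Fin n => Q)
      ≤ indic (n + 1) ω 2 * ∫⁻ y, (g y)⁻¹ ∂Q := by
  obtain ⟨m, rfl⟩ := Nat.exists_eq_succ_of_ne_zero hn
  rcases Nat.eq_zero_or_pos m with rfl | hm
  · have hind : indic (Nat.succ 0 + 1) ω 2 = ω := by simp [indic]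
    rw [hind, Fin.sum_univ_succ]
    simp only [Fin.sum_univ_zero, add_zero, Fin.sum_univ_succ]
    rw [lintegral_pi_eval Q (h := fun y => f y * (g y)⁻¹) _ (hf.mul hg.inv),
      ← lintegral_const_mul' _ _ hω]
    exact lintegral_mono fun y => mul_le_mul' (hfω y) le_rfl
  · have hind : indic (m.succ + 1) ω 2 = 2 := by
      have h1 : m.succ + 1 > 2 := by omega
      have h2 : m.succ + 1 ≠ 2 := by omega
      simp only [indic, if_pos h1, if_neg h2]
      simp
    have hm0 : (m : ℝ≥0∞) ≠ 0 := by exact_mod_cast hm.ne'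
    have hS : Measurable fun z : Fin m → 𝒴 => (∑ l, g (z l))⁻¹ := (measurable_sum_eval hg).inv
    have hj : ∀ j : Fin (m + 1),
        ∫⁻ z, f (z j) * (∑ l, g (z l))⁻¹ ∂(Measure.pi fun _ : Fin (m + 1) => Q)
          ≤ (m : ℝ≥0∞)⁻¹ * ∫⁻ y, (g y)⁻¹ ∂Q := by
      intro j
      calc ∫⁻ z, f (z j) * (∑ l, g (z l))⁻¹ ∂(Measure.pi fun _ : Fin (m + 1) => Q)
          ≤ ∫⁻ z, f (z j) * (∑ l, g (z (j.succAbove l)))⁻¹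
              ∂(Measure.pi fun _ : Fin (m + 1) => Q) := by
            refine lintegral_mono fun z => mul_le_mul' le_rfl (ENNReal.inv_le_inv.2 ?_)
            rw [Fin.sum_univ_succAbove _ j]
            exact le_add_self
        _ = ∫⁻ z, (∑ l, g (z l))⁻¹ ∂(Measure.pi fun _ : Fin m => Q) := by
            rw [lintegral_pi_succAbove Q j (F := fun x z => f x * (∑ l, g (z l))⁻¹)
              ((hf.comp measurable_fst).mul (hS.comp measurable_snd))]
            simp only [lintegral_const_mul _ hS]
            rw [lintegral_mul_const _ hf, hf1, one_mul]
        _ ≤ _ := lintegral_inv_sum_le Q hm.ne' hg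
    rw [hind]
    refine (Finset.sum_le_sum fun j _ => hj j).trans ?_
    rw [Finset.sum_const, Finset.card_univ, Fintype.card_fin, nsmul_eq_mul, ← mul_assoc]
    refine mul_le_mul' ?_ le_rfl
    rw [← div_eq_mul_inv]
    refine ENNReal.div_le_of_le_mul ?_
    have : m + 1 ≤ 2 * m := by omega
    exact_mod_cast this

theorem lintegral_sum_div_sum_le {n : ℕ} (hn : n ≠ 0) {f g : 𝒴 → ℝ≥0∞} (hf : Measurable f)
    (hg : Measurable g) {ω : ℝ≥0∞} (hω : ω ≠ ∞) (hfω : ∀ y, f y ≤ ω) (hf1 : ∫⁻ y, f y ∂Q = 1)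
    (x : 𝒴) :
    ∫⁻ z, (f x + ∑ j, f (z j)) / (g x + ∑ j, g (z j)) ∂(Measure.pi fun _ : Fin n => Q)
      ≤ (ω * (n : ℝ≥0∞)⁻¹ + indic (n + 1) ω 2) * ∫⁻ y, (g y)⁻¹ ∂Q := by
  have hS : Measurable fun z : Fin n → 𝒴 => (∑ l, g (z l))⁻¹ := (measurable_sum_eval hg).inv
  calc ∫⁻ z, (f x + ∑ j, f (z j)) / (g x + ∑ j, g (z j)) ∂(Measure.pi fun _ : Fin n => Q)
      ≤ ∫⁻ z, (ω * (∑ l, g (z l))⁻¹ + ∑ j, f (z j) * (∑ l, g (z l))⁻¹)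
          ∂(Measure.pi fun _ : Fin n => Q) := by
        refine lintegral_mono fun z => ?_
        dsimp only
        rw [← Finset.sum_mul, ← add_mul, div_eq_mul_inv]
        exact mul_le_mul' (add_le_add (hfω x) le_rfl) (ENNReal.inv_le_inv.2 le_add_self)
    _ = ω * ∫⁻ z, (∑ l, g (z l))⁻¹ ∂(Measure.pi fun _ : Fin n => Q)
        + ∑ j, ∫⁻ z, f (z j) * (∑ l, g (z l))⁻¹ ∂(Measure.pi fun _ : Fin n => Q) := by
        rw [lintegral_add_left (hS.const_mul ω), lintegral_const_mul _ hS, lintegral_finsetSum]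
        exact fun j _ => (hf.comp (measurable_pi_apply j)).mul hS
    _ ≤ ω * ((n : ℝ≥0∞)⁻¹ * ∫⁻ y, (g y)⁻¹ ∂Q) + indic (n + 1) ω 2 * ∫⁻ y, (g y)⁻¹ ∂Q := by
        gcongr
        · exact lintegral_inv_sum_le Q hn hg
        · exact sum_lintegral_div_sum_le Q hn hf hg hω hfω hf1
    _ = _ := by ring

theorem mul_one_add_coeff (ω d : ℝ≥0∞) {n : ℕ} :
    ((n + 1 : ℕ) : ℝ≥0∞) * (1 + coeff ω d (n + 1))
      = n + 1 + ω + ω * ((ω * (n : ℝ≥0∞)⁻¹ + indic (n + 1) ω 2) * d) := by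
  have h0 : ((n + 1 : ℕ) : ℝ≥0∞) ≠ 0 := by simp
  have hsub : ((n + 1 : ℕ) : ℝ≥0∞) - 1 = n := by
    rw [Nat.cast_add, Nat.cast_one, ENNReal.add_sub_cancel_right ENNReal.one_ne_top]
  rw [coeff, hsub, mul_add, ← mul_assoc _ (1 / _), one_div,
    ENNReal.mul_inv_cancel h0 (ENNReal.natCast_ne_top _), one_mul, mul_one, div_eq_mul_inv]
  push_cast
  ring

/-- Expanding the product, the mean cost of a match is bounded term by term. -/
theorem lintegral_couplingCost_le {n : ℕ} (hn : n ≠ 0) {pA pB q : 𝒴 → ℝ≥0} (hpA : Measurable pA)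
    (hpB : Measurable pB) (hq : Measurable q) {ω ωA ωB : ℝ≥0∞} (hω : ω ≠ ∞) (hωA : ωA ≤ ω)
    (hωB : ωB ≤ ω) (hA : ∀ y, ratio pA q y ≤ ωA) (hB : ∀ y, ratio pB q y ≤ ωB)
    (hA1 : ∫⁻ y, ratio pA q y ∂Q = 1) (hB1 : ∫⁻ y, ratio pB q y ∂Q = 1) (x : 𝒴)
    (hAx : ratio pA q x ≠ 0) (hBx : ratio pB q x ≠ 0) :
    ∫⁻ z, couplingCost pA pB q ωA ωB x z ∂(Measure.pi fun _ : Fin n => Q)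
      ≤ (n + 1 : ℕ) * (1 + coeff ω (∫⁻ y, (ratio pB q y)⁻¹ ∂Q) (n + 1)
        + ratio pA q x / ratio pB q x * (1 + coeff ω (∫⁻ y, (ratio pA q y)⁻¹ ∂Q) (n + 1))) := by
  have hfm := measurable_ratio hpA hq
  have hgm := measurable_ratio hpB hq
  set f := ratio pA q
  set g := ratio pB q
  set r := f x / g x
  have hft : ∀ y, f y ≠ ∞ := fun y => ne_top_of_le_ne_top hω ((hA y).trans hωA)
  have hgt : ∀ y, g y ≠ ∞ := fun y => ne_top_of_le_ne_top hω ((hB y).trans hωB)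
  have hexp : ∀ z : Fin n → 𝒴, couplingCost pA pB q ωA ωB x z
      ≤ (ωA + ∑ j, f (z j)) + (r * (ωB + ∑ j, g (z j))
        + (ω * ((f x + ∑ j, f (z j)) / (g x + ∑ j, g (z j)))
          + r * (ω * ((g x + ∑ j, g (z j)) / (f x + ∑ j, f (z j)))))) := by
    intro z
    have hS0 : f x + ∑ j, f (z j) ≠ 0 := by simp [hAx]
    have hT0 : g x + ∑ j, g (z j) ≠ 0 := by simp [hBx]
    have hSt : f x + ∑ j, f (z j) ≠ ∞ :=
      ENNReal.add_ne_top.2 ⟨hft x, ENNReal.sum_ne_top.2 fun j _ => hft _⟩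
    have hTt : g x + ∑ j, g (z j) ≠ ∞ :=
      ENNReal.add_ne_top.2 ⟨hgt x, ENNReal.sum_ne_top.2 fun j _ => hgt _⟩
    have hSA : (ωA - f x) + (f x + ∑ j, f (z j)) = ωA + ∑ j, f (z j) := by
      rw [← add_assoc, tsub_add_cancel_of_le (hA x)]
    have hSB : (ωB - g x) + (g x + ∑ j, g (z j)) = ωB + ∑ j, g (z j) := by
      rw [← add_assoc, tsub_add_cancel_of_le (hB x)]
    change (f x + ∑ j, f (z j) + r * (g x + ∑ j, g (z j)))
      * (1 + (ωA - f x) / (f x + ∑ j, f (z j)) + (ωB - g x) / (g x + ∑ j, g (z j))) ≤ _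
    rw [← hSA, ← hSB]
    set S := f x + ∑ j, f (z j)
    set T := g x + ∑ j, g (z j)
    calc (S + r * T) * (1 + (ωA - f x) / S + (ωB - g x) / T)
        = S + S * S⁻¹ * (ωA - f x) + (r * (T + T * T⁻¹ * (ωB - g x))
          + ((ωB - g x) * (S / T) + r * ((ωA - f x) * (T / S)))) := by
          simp only [div_eq_mul_inv]
          ring
      _ = (ωA - f x) + S + (r * ((ωB - g x) + T)
          + ((ωB - g x) * (S / T) + r * ((ωA - f x) * (T / S)))) := by
          rw [ENNReal.mul_inv_cancel hS0 hSt, ENNReal.mul_inv_cancel hT0 hTt, one_mul, one_mul,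
            add_comm S, add_comm T]
      _ ≤ _ := by
          gcongr
          · exact tsub_le_self.trans hωB
          · exact tsub_le_self.trans hωA
  have hSm : Measurable fun z : Fin n → 𝒴 => ∑ j, f (z j) := measurable_sum_eval hfm
  have hTm : Measurable fun z : Fin n → 𝒴 => ∑ j, g (z j) := measurable_sum_eval hgm
  have hquot : Measurable fun z : Fin n → 𝒴 =>
      ω * ((f x + ∑ j, f (z j)) / (g x + ∑ j, g (z j))) :=
    ((hSm.const_add _).div (hTm.const_add _)).const_mul ω
  have hrt : r ≠ ∞ := ENNReal.div_ne_top (hft x) hBx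
  calc ∫⁻ z, couplingCost pA pB q ωA ωB x z ∂(Measure.pi fun _ : Fin n => Q)
      ≤ (ωA + n) + (r * (ωB + n)
        + (ω * ∫⁻ z, (f x + ∑ j, f (z j)) / (g x + ∑ j, g (z j)) ∂(Measure.pi fun _ : Fin n => Q)
          + r * (ω * ∫⁻ z, (g x + ∑ j, g (z j)) / (f x + ∑ j, f (z j))
            ∂(Measure.pi fun _ : Fin n => Q)))) := by
        refine (lintegral_mono hexp).trans (le_of_eq ?_)
        rw [lintegral_add_left (hSm.const_add _), lintegral_add_left
            ((hTm.const_add _).const_mul r), lintegral_add_left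
            hquot,
          lintegral_const_mul' r _ hrt, lintegral_const_mul' r _ hrt, lintegral_const_mul' ω _ hω,
          lintegral_const_mul' ω _ hω, lintegral_add_left measurable_const,
          lintegral_add_left measurable_const, lintegral_pi_sum Q hfm, lintegral_pi_sum Q hgm,
          hA1, hB1]
        simp
    _ ≤ (ω + n) + (r * (ω + n)
        + (ω * ((ω * (n : ℝ≥0∞)⁻¹ + indic (n + 1) ω 2) * ∫⁻ y, (g y)⁻¹ ∂Q)
          + r * (ω * ((ω * (n : ℝ≥0∞)⁻¹ + indic (n + 1) ω 2) * ∫⁻ y, (f y)⁻¹ ∂Q)))) := by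
        gcongr
        · exact lintegral_sum_div_sum_le Q hn hfm hgm hω (fun y => (hA y).trans hωA) hA1 x
        · exact lintegral_sum_div_sum_le Q hn hgm hfm hω (fun y => (hB y).trans hωB) hB1 x
    -- Each bracket on the right contains `N = n + 1`, where only `n` is needed.
    _ ≤ ((n + 1 : ℕ) : ℝ≥0∞) * (1 + coeff ω (∫⁻ y, (g y)⁻¹ ∂Q) (n + 1))
        + r * ((n + 1 : ℕ) * (1 + coeff ω (∫⁻ y, (f y)⁻¹ ∂Q) (n + 1))) := by
        rw [mul_one_add_coeff, mul_one_add_coeff]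
        have h1 : ∀ w : ℝ≥0∞, ω + n + w ≤ n + 1 + ω + w := fun w => by
          rw [add_comm ω]
          gcongr
          exact le_self_add
        refine le_trans (le_of_eq ?_) (add_le_add (h1 _) (mul_le_mul' le_rfl (h1 _)))
        ring
    _ = _ := by ring

end Moments

theorem tendsto_coeff {ω d : ℝ≥0∞} (hω : ω ≠ ∞) (hd : d ≠ ∞) :
    Tendsto (fun n : ℕ => coeff ω d n) atTop (𝓝 0) := by
  have hC : ω + ω * 2 * d + ω ^ 2 * d ≠ ∞ := by finiteness
  have hlim : Tendsto (fun n : ℕ => (n : ℝ≥0∞)⁻¹ * (ω + ω * 2 * d + ω ^ 2 * d)) atTop (𝓝 0) := by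
    have := ENNReal.Tendsto.mul_const ENNReal.tendsto_inv_nat_nhds_zero (Or.inr hC)
    rwa [zero_mul] at this
  refine tendsto_of_tendsto_of_tendsto_of_le_of_le' tendsto_const_nhds hlim
    (Eventually.of_forall fun _ => zero_le) ?_
  filter_upwards [eventually_gt_atTop 2] with n hn
  have hn1 : (1 : ℝ≥0∞) ≤ (n : ℝ≥0∞) - 1 := by
    have : ((n : ℝ≥0∞) - 1) = ((n - 1 : ℕ) : ℝ≥0∞) := by simp
    rw [this]
    exact_mod_cast (by omega : 1 ≤ n - 1)
  have hind : indic n ω 2 = 2 := by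
    simp [indic, hn, hn.ne']
  rw [coeff, hind, one_div]
  gcongr
  exact (ENNReal.div_le_div_left hn1 _).trans (by simp)

/-! ### Densities, conditional probabilities, and the matching bound -/

theorem ratio_div_ratio {𝒴 : Type*} {q : 𝒴 → ℝ≥0} (pA pB : 𝒴 → ℝ≥0) (y : 𝒴)
    (hq : q y ≠ 0) (hB : pB y ≠ 0) :
    ratio pA q y / ratio pB q y = ratio pA pB y := by
  simp only [ratio]
  rw [← ENNReal.coe_div hq, ← ENNReal.coe_div hq, ← ENNReal.coe_div hB,
    ← ENNReal.coe_div (div_ne_zero hB hq), div_div_div_cancel_right₀ hq]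

section Density

variable {𝒴 : Type*} [MeasurableSpace 𝒴] {ν : Measure 𝒴} {p q : 𝒴 → ℝ≥0}

theorem IsDensity.isProbabilityMeasure (hq : IsDensity ν q) :
    IsProbabilityMeasure (densityMeasure ν q) :=
  ⟨by rw [densityMeasure, withDensity_apply _ MeasurableSet.univ, Measure.restrict_univ,
    hq.lintegral_eq_one]⟩

theorem withDensity_ratio (hp : Measurable p) (hq : Measurable q) (h : ∀ y, ratio p q y ≠ ∞) :
    (densityMeasure ν q).withDensity (ratio p q) = densityMeasure ν p := by
  rw [densityMeasure, densityMeasure,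
    ← withDensity_mul ν hq.coe_nnreal_ennreal (measurable_ratio hp hq)]
  congr 1
  ext y
  rw [Pi.mul_apply]
  have hy := h y
  unfold ratio at hy ⊢
  rcases eq_or_ne (q y) 0 with h0 | h0
  · have hp0 : p y = 0 := by
      by_contra hp0
      exact hy (by rw [h0, ENNReal.coe_zero, ENNReal.div_zero (by exact_mod_cast hp0)])
    simp [h0, hp0]
  · exact ENNReal.mul_div_cancel (by exact_mod_cast h0) ENNReal.coe_ne_top

theorem ae_densityMeasure_ne_zero (hq : Measurable q) :
    ∀ᵐ y ∂(densityMeasure ν q), q y ≠ 0 := by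
  rw [densityMeasure, ae_withDensity_iff hq.coe_nnreal_ennreal]
  exact Eventually.of_forall fun y hy => by exact_mod_cast hy

theorem d2_eq_lintegral_inv_ratio (hq : Measurable q) (p : 𝒴 → ℝ≥0) :
    d2 ν q p = ∫⁻ y, (ratio p q y)⁻¹ ∂(densityMeasure ν q) := by
  refine lintegral_congr_ae ((ae_densityMeasure_ne_zero hq).mono fun y hy => ?_)
  simp only [ratio]
  rw [ENNReal.inv_div (Or.inl ENNReal.coe_ne_top) (Or.inl (by exact_mod_cast hy))]

end Density

/-- A lower bound for a conditional probability follows from its integrated form. -/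
theorem ae_le_condProbGiven {Ω 𝒴 : Type*} [MeasurableSpace Ω] [MeasurableSpace 𝒴]
    {μ : Measure Ω} [IsProbabilityMeasure μ] {E : Ω → Prop} {X : Ω → 𝒴} (hX : AEMeasurable X μ)
    (hE : AEMeasurable E μ) {b : 𝒴 → ℝ≥0∞} (hb : Measurable b)
    (h : ∀ D, MeasurableSet D → ∫⁻ y in D, b y ∂(μ.map X) ≤ μ {o | X o ∈ D ∧ E o}) :
    ∀ᵐ y ∂(μ.map X), b y ≤ condProbGiven μ E X y := by
  have : IsProbabilityMeasure (μ.map X) := Measure.isProbabilityMeasure_map hX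
  refine ae_le_of_forall_setLIntegral_le_of_sigmaFinite hb fun D hD _ => ?_
  have hT : MeasurableSet ({True} : Set Prop) := measurableSet_singleton _
  have hcond : ∫⁻ y in D, condProbGiven μ E X y ∂(μ.map X) = μ {o | X o ∈ D ∧ E o} := by
    simp only [condProbGiven]
    rw [← Measure.compProd_apply_prod hD hT, compProd_map_condDistrib hE,
      Measure.map_apply_of_aemeasurable (hX.prodMk hE) (hD.prod hT)]
    congr 1
    ext o
    simp
  rw [hcond]
  exact h D hD

/-- The bound at a single point, from Jensen's inequality for the reciprocal of the cost. -/
theorem inv_bound_le {𝒴 : Type*} [MeasurableSpace 𝒴] (Q : Measure 𝒴) [IsProbabilityMeasure Q]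
    {n : ℕ} (hn : n ≠ 0) {pA pB q : 𝒴 → ℝ≥0} (hpA : Measurable pA)
    (hpB : Measurable pB) (hq : Measurable q) {ω ωA ωB : ℝ≥0∞} (hω : ω ≠ ∞) (hωA : ωA ≤ ω)
    (hωB : ωB ≤ ω) (hA : ∀ y, ratio pA q y ≤ ωA) (hB : ∀ y, ratio pB q y ≤ ωB)
    (hA1 : ∫⁻ y, ratio pA q y ∂Q = 1) (hB1 : ∫⁻ y, ratio pB q y ∂Q = 1) (x : 𝒴)
    (hAx : ratio pA q x ≠ 0) (hBx : ratio pB q x ≠ 0) :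
    (1 + coeff ω (∫⁻ y, (ratio pB q y)⁻¹ ∂Q) (n + 1)
        + ratio pA q x / ratio pB q x * (1 + coeff ω (∫⁻ y, (ratio pA q y)⁻¹ ∂Q) (n + 1)))⁻¹
      ≤ (n + 1 : ℕ) * ∫⁻ z, (couplingCost pA pB q ωA ωB x z)⁻¹
        ∂(Measure.pi fun _ : Fin n => Q) := by
  have hcost := lintegral_couplingCost_le Q hn hpA hpB hq hω hωA hωB hA hB hA1 hB1 x hAx hBx
  set K := 1 + coeff ω (∫⁻ y, (ratio pB q y)⁻¹ ∂Q) (n + 1)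
        + ratio pA q x / ratio pB q x * (1 + coeff ω (∫⁻ y, (ratio pA q y)⁻¹ ∂Q) (n + 1))
  have hm : Measurable fun z : Fin n → 𝒴 => couplingCost pA pB q ωA ωB x z :=
    (measurable_couplingCost hpA hpB hq ωA ωB).comp measurable_prodMk_left
  have hN0 : ((n + 1 : ℕ) : ℝ≥0∞) ≠ 0 := by simp
  have hNt : ((n + 1 : ℕ) : ℝ≥0∞) ≠ ∞ := ENNReal.natCast_ne_top _
  calc K⁻¹ = (n + 1 : ℕ) * ((n + 1 : ℕ) * K)⁻¹ := by
        rw [ENNReal.mul_inv (Or.inl hN0) (Or.inl hNt), ← mul_assoc,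
          ENNReal.mul_inv_cancel hN0 hNt, one_mul]
    _ ≤ (n + 1 : ℕ) * (∫⁻ z, couplingCost pA pB q ωA ωB x z
        ∂(Measure.pi fun _ : Fin n => Q))⁻¹ := mul_le_mul' le_rfl (ENNReal.inv_le_inv.2 hcost)
    _ ≤ _ := mul_le_mul' le_rfl (inv_lintegral_le_lintegral_inv _ hm)

/-- The integrated form of the matching bound: agreement in the first batch already has the
required probability. -/
theorem setLIntegral_inv_bound_le {𝒴 : Type*} [MeasurableSpace 𝒴] {ν : Measure 𝒴}
    {pA pB q : 𝒴 → ℝ≥0} (hpA : IsDensity ν pA) (hpB : IsDensity ν pB) (hq : IsDensity ν q)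
    {ω ωA ωB : ℝ≥0∞} (hω : ω ≠ ∞) (hωA : ωA ≤ ω) (hωB : ωB ≤ ω)
    (hA : ∀ y, ratio pA q y ≤ ωA) (hB : ∀ y, ratio pB q y ≤ ωB)
    {n : ℕ} [NeZero (n + 1)] (hn : n ≠ 0) {D : Set 𝒴} (hD : MeasurableSet D) :
    ∫⁻ y in D, (1 + coeff ω (d2 ν q pB) (n + 1)
        + ratio pA pB y * (1 + coeff ω (d2 ν q pA) (n + 1)))⁻¹ ∂(densityMeasure ν pA)
      ≤ entryLaw (n + 1) (densityMeasure ν q) (matchedIn pA pB q ωA ωB D) := by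
  have := hq.isProbabilityMeasure
  have hAt : ∀ y, ratio pA q y ≠ ∞ := fun y => ne_top_of_le_ne_top hω ((hA y).trans hωA)
  have hBt : ∀ y, ratio pB q y ≠ ∞ := fun y => ne_top_of_le_ne_top hω ((hB y).trans hωB)
  have hone : ∀ {p : 𝒴 → ℝ≥0}, IsDensity ν p → (∀ y, ratio p q y ≠ ∞) →
      ∫⁻ y, ratio p q y ∂(densityMeasure ν q) = 1 := fun {p} hp ht => by
    have := hp.isProbabilityMeasure
    have h := measure_univ (μ := densityMeasure ν p)
    rwa [← withDensity_ratio hp.measurable hq.measurable ht,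
      withDensity_apply _ MeasurableSet.univ, Measure.restrict_univ] at h
  have hAm := measurable_ratio hpA.measurable hq.measurable
  have hBm := measurable_ratio hpB.measurable hq.measurable
  have hABm := measurable_ratio hpA.measurable hpB.measurable
  have hbm : Measurable fun y => (1 + coeff ω (d2 ν q pB) (n + 1)
      + ratio pA pB y * (1 + coeff ω (d2 ν q pA) (n + 1)))⁻¹ :=
    ((hABm.mul_const _).const_add _).inv
  set D' : Set 𝒴 := D ∩ ({y | ratio pA q y = 0}ᶜ ∩ {y | ratio pB q y = 0}ᶜ)
  have hD'm : MeasurableSet D' := hD.inter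
    ((hAm (measurableSet_singleton 0)).compl.inter (hBm (measurableSet_singleton 0)).compl)
  have hmono : matchedIn pA pB q ωA ωB D' ⊆ matchedIn (N := n + 1) pA pB q ωA ωB D :=
    fun e he => ⟨he.1, he.2.1, he.2.2.1⟩
  refine le_trans ?_ ((le_entryLaw_matchedIn hpA.measurable hpB.measurable hq.measurable
    (ne_top_of_le_ne_top hω hωA) (ne_top_of_le_ne_top hω hωB) hA hB (densityMeasure ν q) hD'm
    fun x hx => hx.2).trans (measure_mono hmono))
  rw [← withDensity_ratio hpA.measurable hq.measurable hAt, restrict_withDensity hD,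
    lintegral_withDensity_eq_lintegral_mul _ hAm hbm, ← lintegral_indicator hD,
    ← lintegral_indicator hD'm]
  refine lintegral_mono_ae ((ae_densityMeasure_ne_zero hq.measurable).mono fun y hy => ?_)
  by_cases hyD : y ∈ D
  swap
  · simp [hyD]
  rw [Set.indicator_of_mem hyD, Pi.mul_apply]
  by_cases hA0 : ratio pA q y = 0
  · simp [hA0]
  have hA0' : pA y ≠ 0 := fun h => hA0 (by simp [ratio, h])
  by_cases hB0 : ratio pB q y = 0
  -- The ratio `pA / pB` is infinite in this case, and the bound is zero.
  · have hB0' : pB y = 0 := by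
      simpa [ratio] using hB0
    have : ratio pA pB y = ∞ := by
      rw [ratio, hB0', ENNReal.coe_zero, ENNReal.div_zero (by exact_mod_cast hA0')]
    rw [this, ENNReal.top_mul (by simp)]
    simp
  have hB0' : pB y ≠ 0 := fun h => hB0 (by simp [ratio, h])
  have hyD' : y ∈ D' := ⟨hyD, hA0, hB0⟩
  rw [Set.indicator_of_mem hyD', ← ratio_div_ratio pA pB y hy hB0',
    d2_eq_lintegral_inv_ratio hq.measurable, d2_eq_lintegral_inv_ratio hq.measurable]
  exact mul_le_mul' le_rfl (inv_bound_le _ hn hpA.measurable hpB.measurable hq.measurable hω hωA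
    hωB hA hB (hone hpA hAt) (hone hpB hBt) y hA0 hB0)

end ERSMatching

theorem mainTheorem2 {𝒴 : Type*} [MeasurableSpace 𝒴] [StandardBorelSpace 𝒴]
    (ν : Measure 𝒴) (pA pB q : 𝒴 → ℝ≥0)
    (hpA : ERSMatching.IsDensity ν pA) (hpB : ERSMatching.IsDensity ν pB)
    (hq : ERSMatching.IsDensity ν q)
    (ω : ℝ≥0)
    (hω : max (ERSMatching.supRatio pA q) (ERSMatching.supRatio pB q) ≤ (ω : ℝ≥0∞))
    (N : ℕ) [NeZero N] (hN : 2 ≤ N)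
    {Ω : Type*} [MeasurableSpace Ω] (μ : Measure Ω) [IsProbabilityMeasure μ]
    (W : ℕ → Ω → ERSMatching.Entry N 𝒴)
    (hW : ERSMatching.IsCommonRandomness μ (ERSMatching.densityMeasure ν q) W)
    (YA YB : Ω → 𝒴)
    (hYA : ∀ o, YA o = ERSMatching.sampleAt (fun i => W i o)
      (ERSMatching.ers pA q (ERSMatching.supRatio pA q) (fun i => W i o)))
    (hYB : ∀ o, YB o = ERSMatching.sampleAt (fun i => W i o)
      (ERSMatching.ers pB q (ERSMatching.supRatio pB q) (fun i => W i o))) :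
    (∀ᵐ y ∂(ERSMatching.densityMeasure ν pA),
      (1 + ERSMatching.coeff ω (ERSMatching.d2 ν q pB) N
          + ERSMatching.ratio pA pB y * (1 + ERSMatching.coeff ω (ERSMatching.d2 ν q pA) N))⁻¹
        ≤ ERSMatching.condProbGiven μ (fun o => YA o = YB o) YA y) ∧
    (ERSMatching.d2 ν q pB < ∞ →
      Tendsto (fun n : ℕ => ERSMatching.coeff ω (ERSMatching.d2 ν q pB) n) atTop (𝓝 0)) ∧
    (ERSMatching.d2 ν q pA < ∞ →
      Tendsto (fun n : ℕ => ERSMatching.coeff ω (ERSMatching.d2 ν q pA) n) atTop (𝓝 0)) := by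
  open ERSMatching in
  refine ⟨?_, fun h => tendsto_coeff ENNReal.coe_ne_top h.ne,
    fun h => tendsto_coeff ENNReal.coe_ne_top h.ne⟩
  obtain ⟨n, rfl⟩ : ∃ n, N = n + 1 := ⟨N - 1, by omega⟩
  have hωA : supRatio pA q ≤ ω := (le_max_left _ _).trans hω
  have hωB : supRatio pB q ≤ ω := (le_max_right _ _).trans hω
  have hA : ∀ y, ratio pA q y ≤ supRatio pA q := le_iSup (ratio pA q)
  have hB : ∀ y, ratio pB q y ≤ supRatio pB q := le_iSup (ratio pB q)
  have hωAt : supRatio pA q ≠ ∞ := ne_top_of_le_ne_top ENNReal.coe_ne_top hωA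
  have hYA' : YA = fun o => ersSample pA q (supRatio pA q) fun i => W i o := funext hYA
  have hYB' : YB = fun o => ersSample pB q (supRatio pB q) fun i => W i o := funext hYB
  have hQ := hq.isProbabilityMeasure
  have hPA := withDensity_ratio (ν := ν) hpA.measurable hq.measurable
    fun y => ne_top_of_le_ne_top hωAt (hA y)
  have hprob : IsProbabilityMeasure ((densityMeasure ν q).withDensity (ratio pA q)) :=
    hPA ▸ hpA.isProbabilityMeasure
  have hmap : μ.map YA = densityMeasure ν pA := by
    rw [hYA', hW.map_ersSample hpA.measurable hq.measurable hωAt hA, hPA]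
  have hsA := measurable_ersSample (N := n + 1) hpA.measurable hq.measurable (supRatio pA q)
  have hsB := measurable_ersSample (N := n + 1) hpB.measurable hq.measurable (supRatio pB q)
  have hYAm : AEMeasurable YA μ := hYA' ▸ hsA.comp_aemeasurable hW.aemeasurable
  have hEm : AEMeasurable (fun o => YA o = YB o) μ := by
    have hE : Measurable fun w : ℕ → Entry (n + 1) 𝒴 =>
        ersSample pA q (supRatio pA q) w = ersSample pB q (supRatio pB q) w :=
      measurableSet_setOfPred.1 (measurableSet_eq_fun hsA hsB)
    rw [hYA', hYB']
    exact hE.comp_aemeasurable hW.aemeasurable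
  rw [← hmap]
  refine ae_le_condProbGiven hYAm hEm
    (((measurable_ratio hpA.measurable hpB.measurable).mul_const _).const_add _).inv
    fun D hD => ?_
  rw [hmap, hYA', hYB']
  exact (setLIntegral_inv_bound_le hpA hpB hq ENNReal.coe_ne_top hωA hωB hA hB (by omega) hD).trans
    (hW.entryLaw_matchedIn_le hpA.measurable hpB.measurable hq.measurable _ _ hD)
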